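/- **Setting.** Let $n\ge 1$, let $U\subset\mathbb{R}^n$ be compact and $t_0<t_1$. Let $\mathbf v(\mathbf x,t)$ be a velocity field that is smooth and divergence free on $U\times[t_0,t_1]$, whose trajectories starting in $U$ at time $t_0$ stay in $U$ for $t\in[t_0,t_1]$, and let $\mathbf F_{t_0}^t:U\to U$ be its flow map. Let $\mathbf D(\mathbf x,t)$ be a symmetric, positive definite, Hölder continuous $n\times n$ tensor field on $U\times[t_0,t_1]$. On the interior of $U$ define the transport tensor $$\bar{\mathbf T}_{t_0}^{t_1}=\frac1{t_1-t_0}\int_{t_0}^{t_1}\big[\nabla_0\mathbf F_{t_0}^t\big]^{-1}\,\mathbf D(\mathbf F_{t_0}^t,t)\,\big[\nabla_0\mathbf F_{t_0}^t\big]^{-\top}dt ,$$ and, for a compact embedded $C^1$ hypersurface $\mathcal M$ (possibly with boundary) in the interior of $U$, with unit normal $\mathbf n_0$ (determined up to sign) and area element $dA_0$, define the transport functional $$\mathcal T_{t_0}^{t_1}(\mathcal M)=\frac{\int_{\mathcal M}\langle\mathbf n_0,\bar{\mathbf T}_{t_0}^{t_1}\mathbf n_0\rangle\,dA_0}{\int_{\mathcal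 M}dA_0}.$$ Such a surface $\mathcal M_0$ is called a *uniform minimizer* (*uniform maximizer*) of $\mathcal T_{t_0}^{t_1}$ if the transport density $\langle\mathbf n_0,\bar{\mathbf T}_{t_0}^{t_1}\mathbf n_0\rangle$ is constant along $\mathcal M_0$, and $\mathcal M_0$ is a local minimizer (maximizer): there is $\delta>0$ such that $\mathcal T_{t_0}^{t_1}(\mathcal M_0)\le\mathcal T_{t_0}^{t_1}(\mathcal M)$ (respectively $\ge$) for every surface $\mathcal M=(\mathrm{id}+\mathbf h)(\mathcal M_0)$ in the interior of $U$, where $\mathbf h:\mathbb{R}^n\to\mathbb{R}^n$ is smooth, compactly supported, vanishes near $\partial\mathcal M_0$, and satisfies $|\mathbf h|\le\delta$, $\|\nabla\mathbf h\|\le\delta$ everywhere. **Theorem 1.** Let $\mathcal M_0$ be a compact embedded $C^1$ hypersurface (possibly with boundary) in the interior of $U$, and put $\mathcal T_0=\mathcal T_{t_0}^{t_1}(\mathcal M_0)$ and $\mathbf E_{\mathcal T_0}=\bar{\mathbf T}_{t_0}^{t_1}-\mathcal T_0\mathbf I$. If $\mathcal M_0$ is a uniform minimizer of $\mathcal T_{t_0}^{t_1}$,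 then it is a non-negatively traced null-surface of $\mathbf E_{\mathcal T_0}$, i.e. $$\langle\mathbf n_0(\mathbf x_0),\mathbf E_{\mathcal T_0}(\mathbf x_0)\mathbf n_0(\mathbf x_0)\rangle=0,\qquad \operatorname{trace}\mathbf E_{\mathcal T_0}(\mathbf x_0)\ge 0$$ at every point $\mathbf x_0\in\mathcal M_0$, with $\mathbf n_0(\mathbf x_0)$ the unit normal of $\mathcal M_0$. Similarly, if $\mathcal M_0$ is a uniform maximizer of $\mathcal T_{t_0}^{t_1}$, then at every point $\mathbf x_0\in\mathcal M_0$ $$\langle\mathbf n_0(\mathbf x_0),\mathbf E_{\mathcal T_0}(\mathbf x_0)\mathbf n_0(\mathbf x_0)\rangle=0,\qquad \operatorname{trace}\mathbf E_{\mathcal T_0}(\mathbf x_0)\le 0 .$$ -/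

import Mathlib

open MeasureTheory Topology Set
open scoped ContDiff NNReal RealInnerProductSpace

namespace DiffusiveTransport

/-- Euclidean `n`-space. -/
abbrev Space (n : ℕ) : Type := EuclideanSpace ℝ (Fin n)

/-! ### Velocity field, diffusion tensor, flow map, transport tensor -/

/-- A velocity field that is smooth (jointly in time and space, at every point of
`[t₀, t₁] × U`) and incompressible (divergence free). -/
structure IsIncompressibleSmoothField {n : ℕ} (U : Set (Space n)) (t₀ t₁ : ℝ)
    (v : ℝ → Space n → Space n) : Prop where
  smooth : ∀ t ∈ Icc t₀ t₁, ∀ x ∈ U,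
    ContDiffAt ℝ ∞ (fun q : ℝ × Space n => v q.1 q.2) (t, x)
  div_eq_zero : ∀ t ∈ Icc t₀ t₁, ∀ x ∈ U,
    LinearMap.trace ℝ (Space n) (fderiv ℝ (v t) x : Space n →ₗ[ℝ] Space n) = 0

/-- A diffusion-structure tensor: symmetric, positive definite and Hölder continuous
on `[t₀, t₁] × U`. -/
structure IsDiffusionTensor {n : ℕ} (U : Set (Space n)) (t₀ t₁ : ℝ)
    (D : ℝ → Space n → Space n →L[ℝ] Space n) : Prop where
  symm : ∀ t ∈ Icc t₀ t₁, ∀ x ∈ U, ∀ a b : Space n, ⟪D t x a, b⟫ = ⟪a, D t x b⟫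
  pos : ∀ t ∈ Icc t₀ t₁, ∀ x ∈ U, ∀ a : Space n, a ≠ 0 → 0 < ⟪a, D t x a⟫
  holder : ∃ C α : ℝ≥0, 0 < α ∧ α ≤ 1 ∧
    HolderOnWith C α (fun q : ℝ × Space n => D q.1 q.2) (Icc t₀ t₁ ×ˢ U)

/-- `F t` is the flow map of `v` from time `t₀` to time `t ∈ [t₀, t₁]`: for every `x₀ ∈ U`, the curve
`t ↦ F t x₀` is the trajectory of `v` that starts at `x₀` at time `t₀`, and it stays in `U`. -/
structure IsFlowMap {n : ℕ} (U : Set (Space n)) (t₀ t₁ : ℝ) (v : ℝ → Space n → Space n)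
    (F : ℝ → Space n → Space n) : Prop where
  initial : ∀ x ∈ U, F t₀ x = x
  ode : ∀ x ∈ U, ∀ t ∈ Icc t₀ t₁,
    HasDerivWithinAt (fun s => F s x) (v t (F t x)) (Icc t₀ t₁) t
  mapsTo : ∀ t ∈ Icc t₀ t₁, MapsTo (F t) U U

/-- The tensor `T_{t₀}^t = (∇₀F)⁻¹ D(F, t) (∇₀F)⁻ᵀ`. -/
noncomputable def transportTensorAt {n : ℕ} (D : ℝ → Space n → Space n →L[ℝ] Space n)
    (F : ℝ → Space n → Space n) (t : ℝ) (x : Space n) : Space n →L[ℝ] Space n :=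
  (fderiv ℝ (F t) x).inverse ∘L D t (F t x) ∘L
    ContinuousLinearMap.adjoint (fderiv ℝ (F t) x).inverse

/-- The transport tensor: the average of `T_{t₀}^t` over `t ∈ [t₀, t₁]`. -/
noncomputable def transportTensor {n : ℕ} (D : ℝ → Space n → Space n →L[ℝ] Space n)
    (F : ℝ → Space n → Space n) (t₀ t₁ : ℝ) (x : Space n) : Space n →L[ℝ] Space n :=
  (t₁ - t₀)⁻¹ • ∫ t in t₀..t₁, transportTensorAt D F t x

/-! ### Hypersurfaces -/

/-- `p` is a (relative) interior point of the hypersurface `M`: near `p`, the set `M` is the zero set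
of a `C¹` function with nonzero derivative. -/
def IsInteriorPoint {n : ℕ} (M : Set (Space n)) (p : Space n) : Prop :=
  p ∈ M ∧ ∃ g : Space n → ℝ, ContDiffAt ℝ 1 g p ∧ fderiv ℝ g p ≠ 0 ∧
    ∀ᶠ x in 𝓝 p, x ∈ M ↔ g x = 0

/-- `p` is a boundary point of the hypersurface `M`: near `p`, the set `M` is `{g = 0, b ≥ 0}` with
`C¹` functions `g`, `b` whose derivatives are independent, and `b p = 0`. -/
def IsBoundaryPoint {n : ℕ} (M : Set (Space n)) (p : Space n) : Prop :=
  p ∈ M ∧ ∃ g b : Space n → ℝ, ContDiffAt ℝ 1 g p ∧ ContDiffAt ℝ 1 b p ∧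
    LinearIndependent ℝ ![fderiv ℝ g p, fderiv ℝ b p] ∧ b p = 0 ∧
    ∀ᶠ x in 𝓝 p, x ∈ M ↔ g x = 0 ∧ 0 ≤ b x

/-- Compact embedded `C¹` hypersurfaces of `ℝⁿ` with (possibly empty) boundary. -/
structure IsHypersurface {n : ℕ} (M : Set (Space n)) : Prop where
  isCompact : IsCompact M
  locally_flat : ∀ p ∈ M, IsInteriorPoint M p ∨ IsBoundaryPoint M p

/-- The manifold boundary `∂M`. -/
def boundary {n : ℕ} (M : Set (Space n)) : Set (Space n) := {p ∈ M | ¬ IsInteriorPoint M p}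

/-- `ν` is a unit normal of `M` at `p`: a unit vector orthogonal to all tangent vectors. -/
def IsUnitNormal {n : ℕ} (M : Set (Space n)) (p ν : Space n) : Prop :=
  ‖ν‖ = 1 ∧ ∀ u ∈ tangentConeAt ℝ M p, ⟪ν, u⟫ = 0

open Classical in
/-- A unit normal of `M` at `p` (on a hypersurface it is unique up to sign, and it enters the
transport density only quadratically). -/
noncomputable def unitNormal {n : ℕ} (M : Set (Space n)) (p : Space n) : Space n :=
  if h : ∃ ν, IsUnitNormal M p ν then h.choose else 0

/-! ### The transport functional and its uniform extremizers -/

/-- The transport functional `∫_M ⟨n₀, T̄ n₀⟩ dA₀ / ∫_M dA₀` of a tensor field `Tbar`; the area is the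
`(n-1)`-dimensional Hausdorff measure, normalized to agree with Lebesgue measure on hyperplanes. -/
noncomputable def transportFunctional {n : ℕ} (Tbar : Space n → Space n →L[ℝ] Space n)
    (M : Set (Space n)) : ℝ :=
  (∫ p in M, ⟪unitNormal M p, Tbar p (unitNormal M p)⟫ ∂μHE[n - 1]) / (μHE[n - 1]).real M

/-- The surface obtained from `M` by the perturbation `x ↦ x + h x`. -/
def perturb {n : ℕ} (h : Space n → Space n) (M : Set (Space n)) : Set (Space n) :=
  (fun x => x + h x) '' M

/-- `h` is an admissible perturbation of `M`, of size at most `δ` in the `C¹` norm: a smooth,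
compactly supported displacement field that vanishes near the boundary of `M`. -/
structure IsAdmissible {n : ℕ} (M : Set (Space n)) (δ : ℝ) (h : Space n → Space n) : Prop where
  smooth : ContDiff ℝ ∞ h
  compact_support : HasCompactSupport h
  disjoint_boundary : Disjoint (tsupport h) (boundary M)
  small : ∀ x, ‖h x‖ ≤ δ ∧ ‖fderiv ℝ h x‖ ≤ δ

/-- The transport density `⟨n₀, T̄ n₀⟩` is constant along `M`. -/
def IsUniform {n : ℕ} (Tbar : Space n → Space n →L[ℝ] Space n) (M : Set (Space n)) : Prop :=
  ∃ c : ℝ, ∀ p ∈ M, ∀ ν, IsUnitNormal M p ν → ⟪ν, Tbar p ν⟫ = c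

/-- Uniform minimizers: the transport density is constant along `M`, and `M` minimizes the transport
functional among all `C¹`-small admissible perturbations of `M` inside the open set `W`. -/
def IsUniformMinimizer {n : ℕ} (W : Set (Space n)) (Tbar : Space n → Space n →L[ℝ] Space n)
    (M : Set (Space n)) : Prop :=
  IsUniform Tbar M ∧ ∃ δ > 0, ∀ h, IsAdmissible M δ h → perturb h M ⊆ W →
    transportFunctional Tbar M ≤ transportFunctional Tbar (perturb h M)

/-- Uniform maximizers. -/
def IsUniformMaximizer {n : ℕ} (W : Set (Space n)) (Tbar : Space n → Space n →L[ℝ] Space n)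
    (M : Set (Space n)) : Prop :=
  IsUniform Tbar M ∧ ∃ δ > 0, ∀ h, IsAdmissible M δ h → perturb h M ⊆ W →
    transportFunctional Tbar (perturb h M) ≤ transportFunctional Tbar M

/-- The tensor field `E_c = T̄ - c I`. -/
noncomputable def shiftedTensor {n : ℕ} (Tbar : Space n → Space n →L[ℝ] Space n) (c : ℝ)
    (x : Space n) : Space n →L[ℝ] Space n :=
  Tbar x - c • ContinuousLinearMap.id ℝ (Space n)

/-- `M` is a null-surface of the tensor field `E`: `⟨n₀, E n₀⟩ = 0` at every point of `M`. -/
def IsNullSurface {n : ℕ} (E : Space n → Space n →L[ℝ] Space n) (M : Set (Space n)) : Prop :=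
  ∀ p ∈ M, ∀ ν, IsUnitNormal M p ν → ⟪ν, E p ν⟫ = 0

/-- The trace of a tensor. -/
noncomputable def tensorTrace {n : ℕ} (A : Space n →L[ℝ] Space n) : ℝ :=
  LinearMap.trace ℝ (Space n) (A : Space n →ₗ[ℝ] Space n)

end DiffusiveTransport

open DiffusiveTransport

/-! If the density is a constant `c` along the surface, then its average `T₀` is `c` too, provided
the area is finite and positive. This gives the null-surface identity. The inequality on the trace
comes from a wrinkling argument.

Put `E = T̄ - c I`, and suppose that the trace of `E` is negative at a relative interior point `x₀`
with unit normal `ν`. Since `⟪ν, E ν⟫ = 0`, the trace of `E` over the tangent plane is negative, so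
`⟪e, E e⟫ < 0` for some tangent vector `e`. Near `x₀` the surface is a graph over its tangent plane.
On a graph of slope `p` the vector `N = ν - p` is normal and the area density is `|N|`, so the
excess of the transport density over `c`, times area, is `⟪N, E N⟫ / |N|`. Displace the surface
along `ν` by `s r u((x - x₀) / r)`. As `r → 0` the picture rescaled by `1 / r` flattens to the
tangent plane, with slope `s ∇f`, where `f` is the restriction of `u`, and with the constant tensor
`E(x₀)`. In the integrated excess the term linear in `s` is the integral of a derivative and
vanishes, so the leading term is `s² ∫ ⟪∇f, E(x₀) ∇f⟫`. An `f` that oscillates fast in the direction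
`e` makes it negative. The displacement is small in `C¹`, with slope of order `s` whatever `r` is,
and it leaves the density equal to `c` outside a small ball. The functional therefore drops below
`c`, against minimality.

Boundary points follow because interior points are dense in the surface and the trace of `E` is
continuous. The argument asks only continuity of the tensor field, so maximizers follow on replacing
`T̄` by `-T̄`.

Two analytic facts support this. One is the continuity of `T̄` (`continuousOn_transportTensor`),
which rests on `C¹` dependence of the flow on the initial point. The other is the area formula for
graphs (`IsHyperplaneFrame.comap_graphMap`). The wrinkling itself is carried by
`IsHyperplaneFrame.exists_testFunction`, `exists_integral_graphIntegrand_neg`,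
`IsHyperplaneFrame.eventually_integral_wrinkle_neg` and `IsHypersurface.exists_perturb_lt`. -/

/-! ### Linear differential equations and Grönwall's inequality. -/

section LinearODE

variable {X : Type*} [NormedAddCommGroup X] [NormedSpace ℝ X]

/-- The terms of the Picard series of the linear equation `y' = A y`, `y a = x₀`. -/
noncomputable def picardTerm (A : ℝ → X →L[ℝ] X) (a : ℝ) (x₀ : X) : ℕ → ℝ → X
  | 0 => fun _ => x₀
  | k + 1 => fun t => ∫ s in a..t, A s (picardTerm A a x₀ k s)

theorem continuous_picardTerm {A : ℝ → X →L[ℝ] X} (hA : Continuous A) (a : ℝ) (x₀ : X) (k : ℕ) :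
    Continuous (picardTerm A a x₀ k) := by
  induction k with
  | zero => exact continuous_const
  | succ k ih =>
    exact intervalIntegral.continuous_primitive
      (fun _ _ => (hA.clm_apply ih).intervalIntegrable _ _) a

theorem hasDerivAt_picardTerm_succ [CompleteSpace X] {A : ℝ → X →L[ℝ] X} (hA : Continuous A)
    (a : ℝ) (x₀ : X) (k : ℕ) (t : ℝ) :
    HasDerivAt (picardTerm A a x₀ (k + 1)) (A t (picardTerm A a x₀ k t)) t :=
  (hA.clm_apply (continuous_picardTerm hA a x₀ k)).integral_hasStrictDerivAt a t |>.hasDerivAt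

theorem norm_picardTerm_le {A : ℝ → X →L[ℝ] X} {K : ℝ} (hK : ∀ t, ‖A t‖ ≤ K)
    (a : ℝ) (x₀ : X) (k : ℕ) (t : ℝ) :
    ‖picardTerm A a x₀ k t‖ ≤ (K * |t - a|) ^ k / k.factorial * ‖x₀‖ := by
  have hK0 : 0 ≤ K := (norm_nonneg _).trans (hK 0)
  induction k generalizing t with
  | zero => simp [picardTerm]
  | succ k ih =>
    have hb : ∀ s, ‖A s (picardTerm A a x₀ k s)‖ ≤
        (K ^ (k + 1) / k.factorial * ‖x₀‖) * |s - a| ^ k := fun s => by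
      calc ‖A s (picardTerm A a x₀ k s)‖ ≤ K * ((K * |s - a|) ^ k / k.factorial * ‖x₀‖) :=
            (A s).le_of_opNorm_le_of_le (hK s) (ih s)
        _ = _ := by rw [mul_pow]; ring
    have hint : IntervalIntegrable
        (fun s => (K ^ (k + 1) / k.factorial * ‖x₀‖) * |s - a| ^ k) volume a t :=
      (by fun_prop : Continuous _).intervalIntegrable _ _
    calc ‖∫ s in a..t, A s (picardTerm A a x₀ k s)‖
        ≤ |∫ s in a..t, (K ^ (k + 1) / k.factorial * ‖x₀‖) * |s - a| ^ k| :=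
          intervalIntegral.norm_integral_le_abs_of_norm_le (.of_forall hb) hint
      _ = (K ^ (k + 1) / k.factorial * ‖x₀‖) * (|t - a| ^ (k + 1) / (k + 1)) := by
          rw [intervalIntegral.integral_const_mul, abs_mul, intervalIntegral.abs_intervalIntegral_eq,
            integral_pow_abs_sub_uIoc, abs_of_nonneg (by positivity), abs_of_nonneg (by positivity)]
      _ = _ := by
          rw [mul_pow, Nat.factorial_succ]; push_cast; field_simp

/-- The Picard series is dominated by an exponential series, locally uniformly in time.
Differentiating it termwise shifts the index by one and applies `A`. -/
theorem exists_hasDerivAt_linear [CompleteSpace X] {A : ℝ → X →L[ℝ] X} (hA : Continuous A) {K : ℝ}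
    (hK : ∀ t, ‖A t‖ ≤ K) (a : ℝ) (x₀ : X) :
    ∃ y : ℝ → X, y a = x₀ ∧ ∀ t, HasDerivAt y (A t (y t)) t := by
  have hK0 : 0 ≤ K := (norm_nonneg _).trans (hK 0)
  have hs : ∀ t, Summable fun k => picardTerm A a x₀ k t := fun t =>
    Summable.of_norm_bounded ((Real.summable_pow_div_factorial (K * |t - a|)).mul_right ‖x₀‖)
      fun k => norm_picardTerm_le hK a x₀ k t
  refine ⟨fun t => ∑' k, picardTerm A a x₀ k t, ?_, fun t => ?_⟩
  · change ∑' k, picardTerm A a x₀ k a = x₀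
    rw [tsum_eq_single 0]
    · rfl
    · rintro (_ | k) hk
      · exact absurd rfl hk
      · simp [picardTerm]
  · let R := |t - a| + 1
    -- The zeroth term is constant, hence the derivative `0` there and the shift by one afterwards.
    let g' : ℕ → ℝ → X := fun k s => Nat.casesOn k 0 fun j => A s (picardTerm A a x₀ j s)
    let u : ℕ → ℝ := fun k => Nat.casesOn k 0 fun j => K * ((K * R) ^ j / j.factorial * ‖x₀‖)
    have hu : Summable u := by
      rw [← summable_nat_add_iff 1]
      exact ((Real.summable_pow_div_factorial (K * R)).mul_right ‖x₀‖).mul_left K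
    have key := hasDerivAt_tsum_of_isPreconnected (g := picardTerm A a x₀) (g' := g') (y₀ := t)
      (y := t) hu (Metric.isOpen_ball (x := a) (ε := R)) (convex_ball a R).isPreconnected ?_ ?_
      (by simp [R, Real.dist_eq]) (hs t) (by simp [R, Real.dist_eq])
    · convert key using 1
      rw [Summable.tsum_eq_zero_add]
      · exact ((A t).map_tsum (hs t)).trans (zero_add _).symm
      · rw [← summable_nat_add_iff 1]
        exact (hs t).map (A t) (A t).continuous
    · rintro (_ | k) s -
      · exact hasDerivAt_const _ _
      · exact hasDerivAt_picardTerm_succ hA a x₀ k s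
    · rintro (_ | k) s hs
      · simp [g', u]
      · have hsR : |s - a| ≤ R := by
          rw [Metric.mem_ball, Real.dist_eq] at hs; exact hs.le
        refine (A s).le_of_opNorm_le_of_le (hK s) ((norm_picardTerm_le hK a x₀ k s).trans ?_)
        gcongr

/-- A form of Grönwall's inequality. -/
theorem norm_le_exp_of_hasDerivWithinAt {a b : ℝ} {z z' : ℝ → X} {K δ ε : ℝ} (hK : 1 ≤ K)
    (hδ : 0 ≤ δ) (hε : 0 ≤ ε) (hz : ∀ t ∈ Icc a b, HasDerivWithinAt z (z' t) (Icc a b) t)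
    (ha : ‖z a‖ ≤ δ) (hb : ∀ t ∈ Icc a b, ‖z' t‖ ≤ K * ‖z t‖ + ε) {t : ℝ} (ht : t ∈ Icc a b) :
    ‖z t‖ ≤ (δ + ε) * Real.exp (K * (b - a)) := by
  have h := norm_le_gronwallBound_of_norm_deriv_right_le (f' := z') (δ := δ) (K := K) (ε := ε)
    (fun s hs => (hz s hs).continuousWithinAt)
    (fun s hs => (hz s (Ico_subset_Icc_self hs)).mono_of_mem_nhdsWithin
      (Icc_mem_nhdsGE_of_mem hs)) ha (fun s hs => hb s (Ico_subset_Icc_self hs)) t ht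
  refine h.trans ?_
  rw [gronwallBound_of_K_ne_0 (by positivity)]
  have h1 : Real.exp (K * (t - a)) ≤ Real.exp (K * (b - a)) :=
    Real.exp_le_exp.2 (mul_le_mul_of_nonneg_left (by linarith [ht.2]) (by linarith))
  have h2 : ε / K ≤ ε := div_le_self hε hK
  have h3 : 0 ≤ ε / K := by positivity
  have h4 : 0 < Real.exp (K * (t - a)) := Real.exp_pos _
  have h5 : ε / K * (Real.exp (K * (t - a)) - 1) ≤ ε * Real.exp (K * (b - a)) :=
    (mul_le_mul_of_nonneg_left (by linarith) h3).trans
      (mul_le_mul_of_nonneg_right h2 (Real.exp_pos _).le)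
  simp only
  nlinarith [mul_le_mul_of_nonneg_left h1 hδ]

end LinearODE

/-! ### Differentiability of a flow in the initial condition. -/

section Flow

variable {E : Type*} [NormedAddCommGroup E] [NormedSpace ℝ E] [FiniteDimensional ℝ E]

/-- The fundamental solution of a linear equation and its inverse. -/
theorem exists_fundamentalSolution {a b : ℝ} (hab : a ≤ b) {A : ℝ → E →L[ℝ] E}
    (hA : ContinuousOn A (Icc a b)) {K : ℝ} (hK1 : 1 ≤ K) (hK : ∀ t ∈ Icc a b, ‖A t‖ ≤ K) :
    ∃ Y Z : ℝ → E →L[ℝ] E, Y a = 1 ∧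
      (∀ t ∈ Icc a b, HasDerivWithinAt Y (A t * Y t) (Icc a b) t) ∧
      (∀ t, Z t * Y t = 1 ∧ Y t * Z t = 1) ∧
      (∀ t ∈ Icc a b, ‖Y t‖ ≤ Real.exp (K * (b - a))) ∧
      ∀ t ∈ Icc a b, ‖Z t‖ ≤ Real.exp (K * (b - a)) := by
  have : CompleteSpace E := FiniteDimensional.complete ℝ E
  let B : ℝ → E →L[ℝ] E := fun t => A (projIcc a b hab t)
  have hB : Continuous B := by
    have := (continuousOn_iff_continuous_domRestrict.1 hA).comp (continuous_projIcc (h := hab))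
    exact this
  have hBK : ∀ t, ‖B t‖ ≤ K := fun t => hK _ (projIcc a b hab t).2
  have hBA : ∀ t ∈ Icc a b, B t = A t := fun t ht => by simp [B, projIcc_of_mem hab ht]
  obtain ⟨Y, hY0, hY⟩ := exists_hasDerivAt_linear (X := E →L[ℝ] E)
    (A := fun t => ContinuousLinearMap.mul ℝ (E →L[ℝ] E) (B t))
    ((ContinuousLinearMap.mul ℝ (E →L[ℝ] E)).continuous.comp hB) (K := K)
    (fun t => (ContinuousLinearMap.opNorm_mul_apply_le _ _ _).trans (hBK t)) a 1
  -- `Z` solves the adjoint equation `Z' = -Z A`, chosen so that `(Z Y)' = 0`.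
  obtain ⟨Z, hZ0, hZ⟩ := exists_hasDerivAt_linear (X := E →L[ℝ] E)
    (A := fun t => -(ContinuousLinearMap.mul ℝ (E →L[ℝ] E)).flip (B t))
    ((ContinuousLinearMap.mul ℝ (E →L[ℝ] E)).flip.continuous.comp hB).neg (K := K)
    (fun t => by
      rw [norm_neg]
      refine ((ContinuousLinearMap.mul ℝ (E →L[ℝ] E)).flip.le_opNorm _).trans ?_
      rw [ContinuousLinearMap.opNorm_flip]
      refine (mul_le_mul_of_nonneg_right (ContinuousLinearMap.opNorm_mul_le _ _)
        (norm_nonneg _)).trans ?_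
      rw [one_mul]; exact hBK t) a 1
  simp only [ContinuousLinearMap.mul_apply', neg_apply,
    ContinuousLinearMap.flip_apply] at hY hZ
  have hZY : ∀ t, Z t * Y t = 1 := fun t => by
    have h : ∀ s, HasDerivAt (fun s => Z s * Y s) 0 s := fun s =>
      ((hZ s).mul (hY s)).congr_deriv (by rw [neg_mul, mul_assoc, neg_add_cancel])
    have := is_const_of_deriv_eq_zero (fun s => (h s).differentiableAt) (fun s => (h s).deriv) t a
    simpa [hZ0, hY0] using this
  -- In finite dimension a left inverse is a right inverse.
  have hYZ : ∀ t, Y t * Z t = 1 := fun t => by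
    have h : (Z t : E →ₗ[ℝ] E) * (Y t : E →ₗ[ℝ] E) = 1 := by
      have := congrArg (fun f : E →L[ℝ] E => (f : E →ₗ[ℝ] E)) (hZY t)
      exact this
    have h' := mul_eq_one_comm.1 h
    ext x
    exact congrArg (fun f : E →ₗ[ℝ] E => f x) h'
  have hone : ‖(1 : E →L[ℝ] E)‖ ≤ 1 := ContinuousLinearMap.norm_id_le
  refine ⟨Y, Z, hY0, fun t ht => ?_, fun t => ⟨hZY t, hYZ t⟩, fun t ht => ?_, fun t ht => ?_⟩
  · rw [← hBA t ht]; exact (hY t).hasDerivWithinAt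
  · have := norm_le_exp_of_hasDerivWithinAt hK1 zero_le_one le_rfl
      (fun s _ => (hY s).hasDerivWithinAt) (by rwa [hY0])
      (fun s _ => by
        rw [add_zero]
        exact (norm_mul_le _ _).trans (mul_le_mul_of_nonneg_right (hBK s) (norm_nonneg _))) ht
    simpa using this
  · have := norm_le_exp_of_hasDerivWithinAt hK1 zero_le_one le_rfl
      (fun s _ => (hZ s).hasDerivWithinAt) (by rwa [hZ0])
      (fun s _ => by
        rw [add_zero, norm_neg, mul_comm]
        exact (norm_mul_le _ _).trans (mul_le_mul_of_nonneg_left (hBK s) (norm_nonneg _))) ht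
    simpa using this

end Flow

section FlowDerivative

variable {E : Type*} [NormedAddCommGroup E] [NormedSpace ℝ E]

/-- The spatial derivative of a time-dependent field. -/
noncomputable def spatialDeriv (w : ℝ × E → E) (q : ℝ × E) : E →L[ℝ] E :=
  (fderiv ℝ w q).comp (ContinuousLinearMap.inr ℝ ℝ E)

theorem hasFDerivAt_slice {w : ℝ × E → E} (hw : ContDiff ℝ 1 w) (t : ℝ) (z : E) :
    HasFDerivAt (fun z => w (t, z)) (spatialDeriv w (t, z)) z :=
  ((hw.differentiable one_ne_zero) (t, z)).hasFDerivAt.comp z (hasFDerivAt_prodMk_right t z)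

theorem continuous_spatialDeriv {w : ℝ × E → E} (hw : ContDiff ℝ 1 w) :
    Continuous (spatialDeriv w) :=
  (hw.continuous_fderiv one_ne_zero).clm_comp continuous_const

theorem hasCompactSupport_spatialDeriv {w : ℝ × E → E} (hc : HasCompactSupport w) :
    HasCompactSupport (spatialDeriv w) :=
  (hc.fderiv ℝ).comp_left (g := fun L : ℝ × E →L[ℝ] E => L.comp (ContinuousLinearMap.inr ℝ ℝ E))
    (ContinuousLinearMap.zero_comp _)

theorem exists_bound_spatialDeriv {w : ℝ × E → E} (hw : ContDiff ℝ 1 w)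
    (hc : HasCompactSupport w) : ∃ K, 1 ≤ K ∧ ∀ q, ‖spatialDeriv w q‖ ≤ K := by
  obtain ⟨C, hC⟩ := (hasCompactSupport_spatialDeriv hc).exists_bound_of_continuous
    (continuous_spatialDeriv hw)
  exact ⟨max 1 C, le_max_left _ _, fun q => (hC q).trans (le_max_right _ _)⟩

theorem norm_slice_sub_le {w : ℝ × E → E} (hw : ContDiff ℝ 1 w) {K : ℝ}
    (hK : ∀ q, ‖spatialDeriv w q‖ ≤ K) (t : ℝ) (y z : E) :
    ‖w (t, y) - w (t, z)‖ ≤ K * ‖y - z‖ :=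
  convex_univ.norm_image_sub_le_of_norm_hasFDerivWithin_le
    (fun x _ => (hasFDerivAt_slice hw t x).hasFDerivWithinAt) (fun x _ => hK (t, x))
    (mem_univ z) (mem_univ y)

/-- Compact support makes the spatial derivative uniformly continuous, so one `η` serves all times;
Grönwall's inequality needs this uniformity. -/
theorem exists_spatialDeriv_close {w : ℝ × E → E} (hw : ContDiff ℝ 1 w)
    (hc : HasCompactSupport w) {ε : ℝ} (hε : 0 < ε) :
    ∃ η > 0, ∀ (t : ℝ) (y z : E), ‖y - z‖ < η →
      ‖spatialDeriv w (t, y) - spatialDeriv w (t, z)‖ ≤ ε := by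
  have hu := (hasCompactSupport_spatialDeriv hc).uniformContinuous_of_continuous
    (continuous_spatialDeriv hw)
  obtain ⟨η, hη, h⟩ := Metric.uniformContinuous_iff.1 hu ε hε
  refine ⟨η, hη, fun t y z hyz => ?_⟩
  rw [← dist_eq_norm]
  refine (h ?_).le
  rw [Prod.dist_eq, dist_self, dist_eq_norm]
  exact max_lt hη hyz

theorem norm_slice_taylor_le {w : ℝ × E → E} (hw : ContDiff ℝ 1 w) {ε η : ℝ}
    (h : ∀ (t : ℝ) (y z : E), ‖y - z‖ < η →
      ‖spatialDeriv w (t, y) - spatialDeriv w (t, z)‖ ≤ ε) (t : ℝ) {y z : E} (hyz : ‖y - z‖ < η) :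
    ‖w (t, y) - w (t, z) - spatialDeriv w (t, z) (y - z)‖ ≤ ε * ‖y - z‖ :=
  (convex_ball z η).norm_image_sub_le_of_norm_hasFDerivWithin_le'
    (fun x _ => (hasFDerivAt_slice hw t x).hasFDerivWithinAt)
    (fun x hx => h t x z (by rwa [← dist_eq_norm])) (by
      have := (norm_nonneg _).trans_lt hyz
      simpa using this) (by rwa [Metric.mem_ball, dist_eq_norm])

/-- A flow of a compactly supported `C¹` field is continuously differentiable in the initial
condition, with an invertible derivative. -/
theorem exists_flow_derivative [FiniteDimensional ℝ E] {w : ℝ × E → E} (hw : ContDiff ℝ 1 w)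
    (hc : HasCompactSupport w) {a b : ℝ} (hab : a ≤ b) {O : Set E} (hO : IsOpen O)
    {F : ℝ → E → E} (hF0 : ∀ x ∈ O, F a x = x)
    (hF : ∀ x ∈ O, ∀ t ∈ Icc a b,
      HasDerivWithinAt (fun s => F s x) (w (t, F t x)) (Icc a b) t) :
    ∃ (Y Z : E → ℝ → E →L[ℝ] E) (C : ℝ),
      (∀ x ∈ O, ∀ t ∈ Icc a b, HasFDerivAt (F t) (Y x t) x ∧ Z x t * Y x t = 1 ∧
        Y x t * Z x t = 1 ∧ ‖Z x t‖ ≤ C) ∧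
      (∀ x ∈ O, ContinuousOn (Y x) (Icc a b)) ∧
      ∀ t ∈ Icc a b, ContinuousOn (fun x => Y x t) O := by
  obtain ⟨K, hK1, hK⟩ := exists_bound_spatialDeriv hw hc
  set C := Real.exp (K * (b - a)) with hC
  have hC0 : 0 < C := Real.exp_pos _
  have hFc : ∀ x ∈ O, ContinuousOn (fun s => F s x) (Icc a b) := fun x hx t ht =>
    (hF x hx t ht).continuousWithinAt
  have hlip : ∀ x ∈ O, ∀ y ∈ O, ∀ t ∈ Icc a b, ‖F t y - F t x‖ ≤ ‖y - x‖ * C := by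
    intro x hx y hy t ht
    have := norm_le_exp_of_hasDerivWithinAt (z := fun s => F s y - F s x) (δ := ‖y - x‖) (ε := 0)
      hK1 (norm_nonneg _) le_rfl (fun s hs => (hF y hy s hs).sub (hF x hx s hs))
      (by rw [hF0 x hx, hF0 y hy])
      (fun s hs => by rw [add_zero]; exact norm_slice_sub_le hw hK s _ _) ht
    simpa using this
  have hex : ∀ x : E, ∃ Y Z : ℝ → E →L[ℝ] E, x ∈ O → Y a = 1 ∧
      (∀ t ∈ Icc a b, HasDerivWithinAt Y (spatialDeriv w (t, F t x) * Y t) (Icc a b) t) ∧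
      (∀ t, Z t * Y t = 1 ∧ Y t * Z t = 1) ∧
      (∀ t ∈ Icc a b, ‖Y t‖ ≤ C) ∧ ∀ t ∈ Icc a b, ‖Z t‖ ≤ C := by
    intro x
    by_cases hx : x ∈ O
    · obtain ⟨Y, Z, h⟩ := exists_fundamentalSolution hab
        (A := fun t => spatialDeriv w (t, F t x))
        ((continuous_spatialDeriv hw).comp_continuousOn (continuousOn_id.prodMk (hFc x hx)))
        hK1 (fun t _ => hK _)
      exact ⟨Y, Z, fun _ => h⟩
    · exact ⟨0, 0, fun h => absurd h hx⟩
  choose Y Z hYZ using hex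
  refine ⟨Y, Z, C, fun x hx t ht => ⟨?_, ((hYZ x hx).2.2.1 t).1, ((hYZ x hx).2.2.1 t).2,
    (hYZ x hx).2.2.2.2 t ht⟩, fun x hx t ht => ((hYZ x hx).2.1 t ht).continuousWithinAt, ?_⟩
  · rw [hasFDerivAt_iff_isLittleO_nhds_zero, Asymptotics.isLittleO_iff]
    intro ε hε
    -- One factor `C` will be lost to the Lipschitz bound of the flow, the other to Grönwall's
    -- inequality.
    obtain ⟨η, hη, hcl⟩ := exists_spatialDeriv_close hw hc (ε := ε / (C * C)) (by positivity)
    have hOx : ∀ᶠ h in 𝓝 (0 : E), x + h ∈ O :=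
      (by fun_prop : Continuous fun h : E => x + h).continuousAt.eventually_mem
        (by simpa using hO.mem_nhds hx)
    have hsm : ∀ᶠ h in 𝓝 (0 : E), ‖h‖ * C < η :=
      (by fun_prop : Continuous fun h : E => ‖h‖ * C).continuousAt.eventually_lt
        continuousAt_const (by simpa using hη)
    filter_upwards [hOx, hsm] with h hh hhη
    have hd : ∀ s ∈ Icc a b, ‖F s (x + h) - F s x‖ ≤ ‖h‖ * C := fun s hs => by
      simpa using hlip x hx (x + h) hh s hs
    -- The first-order remainder of the flow solves the linearized equation up to the Taylor error
    -- of `w`, which is `o(‖h‖)` uniformly in time, and it starts at `0`.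
    have := norm_le_exp_of_hasDerivWithinAt (z := fun s => F s (x + h) - F s x - Y x s h)
      (z' := fun s => w (s, F s (x + h)) - w (s, F s x) - (spatialDeriv w (s, F s x) * Y x s) h)
      (δ := 0) (ε := ε / (C * C) * (‖h‖ * C)) hK1 le_rfl (by positivity)
      (fun s hs => ((hF _ hh s hs).sub (hF x hx s hs)).sub
        (((hYZ x hx).2.1 s hs).clm_apply (hasDerivWithinAt_const _ _ h) |>.congr_deriv (by simp)))
      (by simp [hF0 x hx, hF0 _ hh, (hYZ x hx).1]) (fun s hs => ?_) ht
    · refine this.trans (le_of_eq ?_)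
      rw [← hC]; field_simp; ring
    · have h1 := norm_slice_taylor_le hw hcl s ((hd s hs).trans_lt hhη)
      have h2 : w (s, F s (x + h)) - w (s, F s x) - (spatialDeriv w (s, F s x) * Y x s) h =
          spatialDeriv w (s, F s x) (F s (x + h) - F s x - Y x s h) +
          (w (s, F s (x + h)) - w (s, F s x) -
            spatialDeriv w (s, F s x) (F s (x + h) - F s x)) := by
        rw [map_sub (spatialDeriv w (s, F s x)) (F s (x + h) - F s x)]
        simp only [mul_apply_eq_comp]; abel
      rw [h2]
      refine (norm_add_le _ _).trans (add_le_add
        ((spatialDeriv w (s, F s x)).le_of_opNorm_le (hK _) _) (h1.trans ?_))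
      exact mul_le_mul_of_nonneg_left (hd s hs) (by positivity)
  · intro t ht x hx
    refine ContinuousAt.continuousWithinAt (Metric.continuousAt_iff'.2 fun ε hε => ?_)
    obtain ⟨η, hη, hcl⟩ := exists_spatialDeriv_close hw hc (ε := ε / 2 / (C * C)) (by positivity)
    have hsm : ∀ᶠ y in 𝓝 x, ‖y - x‖ * C < η :=
      (by fun_prop : Continuous fun y : E => ‖y - x‖ * C).continuousAt.eventually_lt
        continuousAt_const (by simpa using hη)
    filter_upwards [hO.mem_nhds hx, hsm] with y hy hyη
    -- The difference of two fundamental solutions solves the linear equation along one trajectory,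
    -- with a forcing term that measures how far `spatialDeriv w` differs between the two
    -- trajectories.
    have := norm_le_exp_of_hasDerivWithinAt (z := fun s => Y y s - Y x s)
      (δ := 0) (ε := ε / 2 / (C * C) * C) hK1 le_rfl (by positivity)
      (fun s hs => ((hYZ y hy).2.1 s hs).sub ((hYZ x hx).2.1 s hs))
      (by simp [(hYZ x hx).1, (hYZ y hy).1]) (fun s hs => ?_) ht
    · rw [dist_eq_norm]
      refine this.trans_lt ?_
      rw [← hC]
      have : (0 + ε / 2 / (C * C) * C) * C = ε / 2 := by field_simp; ring
      rw [this]; linarith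
    · have h2 : spatialDeriv w (s, F s y) * Y y s - spatialDeriv w (s, F s x) * Y x s =
          spatialDeriv w (s, F s y) * (Y y s - Y x s) +
          (spatialDeriv w (s, F s y) - spatialDeriv w (s, F s x)) * Y x s := by
        rw [mul_sub, sub_mul]; abel
      rw [h2]
      refine (norm_add_le _ _).trans (add_le_add ((norm_mul_le _ _).trans
        (mul_le_mul_of_nonneg_right (hK _) (norm_nonneg _))) ((norm_mul_le _ _).trans ?_))
      exact mul_le_mul (hcl s _ _ ((hlip x hx y hy s hs).trans_lt hyη))
        ((hYZ x hx).2.2.2.1 s hs) (norm_nonneg _) (by positivity)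

end FlowDerivative

/-! ### Cutoffs and the continuity of the transport tensor. -/

section Cutoff

open scoped Manifold

/-- Multiplication by a bump function equal to `1` near `K`. It replaces the velocity field, and
later the implicit function, by a globally defined one. -/
theorem exists_contDiff_hasCompactSupport_eventuallyEq {E G : Type*} [NormedAddCommGroup E]
    [NormedSpace ℝ E] [FiniteDimensional ℝ E] [NormedAddCommGroup G] [NormedSpace ℝ G] {f : E → G}
    {K : Set E} (hK : IsCompact K) (hf : ∀ x ∈ K, ContDiffAt ℝ 1 f x) :
    ∃ g : E → G, ContDiff ℝ 1 g ∧ HasCompactSupport g ∧ ∀ x ∈ K, g =ᶠ[𝓝 x] f := by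
  have hO : IsOpen {x | ContDiffAt ℝ 1 f x} :=
    isOpen_iff_mem_nhds.2 fun x hx =>
      ContDiffAt.eventually (f := f) (n := 1) hx (by simp)
  obtain ⟨L, hL, hKL, hLO⟩ := exists_compact_between hK hO hf
  obtain ⟨χ, hχ1, hχ0, -⟩ := exists_contMDiffMap_one_nhds_of_subset_interior (n := 1) 𝓘(ℝ, E)
    hK.isClosed hKL
  have hχ : ContDiff ℝ 1 χ := contMDiff_iff_contDiff.1 χ.contMDiff
  refine ⟨fun x => χ x • f x, contDiff_iff_contDiffAt.2 fun x => ?_, ?_, fun x hx => ?_⟩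
  · by_cases hx : x ∈ L
    · exact hχ.contDiffAt.smul (hLO hx)
    · refine (contDiffAt_const (c := (0 : G))).congr_of_eventuallyEq ?_
      filter_upwards [hL.isClosed.isOpen_compl.mem_nhds hx] with y hy
      rw [hχ0 y hy, zero_smul]
  · exact HasCompactSupport.intro hL fun x hx => by rw [hχ0 x hx, zero_smul]
  · filter_upwards [Filter.eventually_of_mem (mem_nhdsSet_iff_forall.1 hχ1 x hx) fun _ h => h]
      with y hy
    have hy' : χ y = 1 := hy
    rw [hy', one_smul]

end Cutoff

namespace DiffusiveTransport

/-- Trajectories stay in `U`, so they also solve the equation of a compactly supported extension of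
`v`. The integrand is then continuous in `x` and uniformly bounded, and dominated convergence
applies. -/
theorem continuousOn_transportTensor {n : ℕ} {U : Set (Space n)} (hU : IsCompact U)
    {t₀ t₁ : ℝ} (ht : t₀ < t₁) {v : ℝ → Space n → Space n}
    (hv : IsIncompressibleSmoothField U t₀ t₁ v)
    {D : ℝ → Space n → Space n →L[ℝ] Space n} (hD : IsDiffusionTensor U t₀ t₁ D)
    {F : ℝ → Space n → Space n} (hF : IsFlowMap U t₀ t₁ v F) :
    ContinuousOn (transportTensor D F t₀ t₁) (interior U) := by
  obtain ⟨w, hw, hc, hwv⟩ := exists_contDiff_hasCompactSupport_eventuallyEq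
    (f := fun q : ℝ × Space n => v q.1 q.2) ((isCompact_Icc (a := t₀) (b := t₁)).prod hU)
    fun q hq => (hv.smooth q.1 hq.1 q.2 hq.2).of_le (by simp)
  have hO := isOpen_interior (s := U)
  have hOU : ∀ {x}, x ∈ interior U → x ∈ U := fun h => interior_subset h
  obtain ⟨Y, Z, C, hYZ, hYt, hYx⟩ := exists_flow_derivative hw hc ht.le hO
    (fun x hx => hF.initial x (hOU hx)) (fun x hx t ht => by
      rw [(hwv (t, F t x) ⟨ht, hF.mapsTo t ht (hOU hx)⟩).self_of_nhds]
      exact hF.ode x (hOU hx) t ht)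
  obtain ⟨c, α, hα, -, hH⟩ := hD.holder
  have hDc : ContinuousOn (fun q : ℝ × Space n => D q.1 q.2) (Icc t₀ t₁ ×ˢ U) :=
    hH.continuousOn hα
  obtain ⟨B, hB⟩ := ((isCompact_Icc (a := t₀) (b := t₁)).prod hU).exists_bound_of_continuousOn hDc
  have hZ : ∀ x ∈ interior U, ∀ t ∈ Icc t₀ t₁, (fderiv ℝ (F t) x).inverse = Z x t := by
    intro x hx t ht
    obtain ⟨h1, h2, h3, -⟩ := hYZ x hx t ht
    rw [h1.fderiv]
    exact ContinuousLinearMap.inverse_eq h3 h2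
  -- Writing `Z` as a ring inverse transfers the continuity of `Y`, in time and in space, to `Z`.
  have hZinv : ∀ x ∈ interior U, ∀ t ∈ Icc t₀ t₁, Z x t = Ring.inverse (Y x t) := by
    intro x hx t ht
    obtain ⟨-, h2, h3, -⟩ := hYZ x hx t ht
    exact (Ring.inverse_unit ⟨Y x t, Z x t, h3, h2⟩).symm
  have hinv : ∀ x ∈ interior U, ∀ t ∈ Icc t₀ t₁,
      ContinuousAt (Ring.inverse : (Space n →L[ℝ] Space n) → _) (Y x t) := by
    intro x hx t ht
    obtain ⟨-, h2, h3, -⟩ := hYZ x hx t ht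
    exact NormedRing.inverse_continuousAt ⟨Y x t, Z x t, h3, h2⟩
  have hZt : ∀ x ∈ interior U, ContinuousOn (Z x) (Icc t₀ t₁) := fun x hx =>
    ContinuousOn.congr (fun t ht => (hinv x hx t ht).comp_continuousWithinAt (hYt x hx t ht))
      fun t ht => hZinv x hx t ht
  have hZx : ∀ t ∈ Icc t₀ t₁, ContinuousOn (fun x => Z x t) (interior U) := fun t ht =>
    ContinuousOn.congr (fun x hx => ContinuousAt.comp_continuousWithinAt
      (g := Ring.inverse) (f := fun x => Y x t) (hinv x hx t ht) (hYx t ht x hx))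
      fun x hx => hZinv x hx t ht
  have hT : ∀ x ∈ interior U, ∀ t ∈ Icc t₀ t₁, transportTensorAt D F t x =
      Z x t ∘L D t (F t x) ∘L ContinuousLinearMap.adjoint (Z x t) := by
    intro x hx t ht
    rw [transportTensorAt, hZ x hx t ht]
  have hFt : ∀ x ∈ interior U, ContinuousOn (fun t => F t x) (Icc t₀ t₁) := fun x hx t ht =>
    (hF.ode x (hOU hx) t ht).continuousWithinAt
  have hsub : uIoc t₀ t₁ ⊆ Icc t₀ t₁ := by rw [uIoc_of_le ht.le]; exact Ioc_subset_Icc_self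
  intro x hx
  refine ContinuousAt.continuousWithinAt ?_
  refine ContinuousAt.const_smul (g := fun x => ∫ t in t₀..t₁, transportTensorAt D F t x) ?_
    (t₁ - t₀)⁻¹
  refine intervalIntegral.continuousAt_of_dominated_interval
    (bound := fun _ => C * (B * C)) ?_ ?_ ?_ ?_
  · filter_upwards [hO.mem_nhds hx] with y hy
    refine ContinuousOn.aestronglyMeasurable ?_ measurableSet_uIoc
    refine ContinuousOn.mono ?_ hsub
    refine ContinuousOn.congr ?_ (fun t ht => hT y hy t ht)
    refine (hZt y hy).clm_comp (ContinuousOn.clm_comp ?_ ?_)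
    · exact hDc.comp (continuousOn_id.prodMk (hFt y hy))
        fun t ht => ⟨ht, hF.mapsTo t ht (hOU hy)⟩
    · exact ContinuousLinearMap.adjoint.continuous.comp_continuousOn (hZt y hy)
  · filter_upwards [hO.mem_nhds hx] with y hy
    refine .of_forall fun t ht' => ?_
    have ht := hsub ht'
    rw [hT y hy t ht]
    have hZn := (hYZ y hy t ht).2.2.2
    have hC0 : 0 ≤ C := (norm_nonneg _).trans hZn
    have hBn := hB (t, F t y) ⟨ht, hF.mapsTo t ht (hOU hy)⟩
    refine (ContinuousLinearMap.opNorm_comp_le _ _).trans (mul_le_mul hZn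
      ((ContinuousLinearMap.opNorm_comp_le _ _).trans (mul_le_mul hBn ?_ (norm_nonneg _)
        ((norm_nonneg _).trans hBn))) (norm_nonneg _) hC0)
    rw [LinearIsometryEquiv.norm_map]; exact hZn
  · exact intervalIntegrable_const
  · refine .of_forall fun t ht' => ?_
    have ht := hsub ht'
    refine ContinuousOn.continuousAt (s := interior U) ?_ (hO.mem_nhds hx)
    refine ContinuousOn.congr ?_ (fun y hy => hT y hy t ht)
    refine (hZx t ht).clm_comp (ContinuousOn.clm_comp ?_ ?_)
    · refine hDc.comp (continuousOn_const.prodMk fun y hy => ?_)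
        fun y hy => ⟨ht, hF.mapsTo t ht (hOU hy)⟩
      exact (hYZ y hy t ht).1.continuousAt.continuousWithinAt
    · exact ContinuousLinearMap.adjoint.continuous.comp_continuousOn (hZx t ht)

end DiffusiveTransport

/-! ### Hausdorff measure and the area formula for graphs. -/

section HausdorffComparison

open scoped ENNReal

variable {X Y Z : Type*} [MetricSpace X] [MeasurableSpace X] [BorelSpace X]
  [MetricSpace Y] [MeasurableSpace Y] [BorelSpace Y]

theorem LipschitzOnWith.euclideanHausdorffMeasure_image_le {K : ℝ≥0} {f : X → Y} {s : Set X}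
    (h : LipschitzOnWith K f s) (d : ℕ) : μHE[d] (f '' s) ≤ (K : ℝ≥0∞) ^ d * μHE[d] s := by
  rw [Measure.euclideanHausdorffMeasure_def, Measure.euclideanHausdorffMeasure_def,
    Measure.smul_apply, Measure.smul_apply, ENNReal.smul_def, ENNReal.smul_def, smul_eq_mul,
    smul_eq_mul, mul_left_comm]
  gcongr
  simpa using h.hausdorffMeasure_image_le (d := d) (by positivity)

/-- The hypothesis makes `f` factor through `g` by a `K`-Lipschitz map on `g '' s`, even when `g` is
not injective. -/
theorem euclideanHausdorffMeasure_image_le_of_dist_le {K : ℝ≥0} {f : Z → Y} {g : Z → X} {s : Set Z}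
    (h : ∀ a ∈ s, ∀ b ∈ s, dist (f a) (f b) ≤ K * dist (g a) (g b)) (d : ℕ) :
    μHE[d] (f '' s) ≤ (K : ℝ≥0∞) ^ d * μHE[d] (g '' s) := by
  rcases s.eq_empty_or_nonempty with rfl | ⟨z, hz⟩
  · simp
  have : Nonempty Z := ⟨z⟩
  let k : X → Z := Function.invFunOn g s
  have hk : ∀ a ∈ s, k (g a) ∈ s ∧ g (k (g a)) = g a := fun a ha =>
    ⟨Function.invFunOn_mem ⟨a, ha, rfl⟩, Function.invFunOn_eq ⟨a, ha, rfl⟩⟩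
  have hfk : ∀ a ∈ s, f (k (g a)) = f a := fun a ha => by
    have := h _ (hk a ha).1 a ha
    rw [(hk a ha).2, dist_self, mul_zero] at this
    exact dist_le_zero.1 this
  have himg : f '' s = (f ∘ k) '' (g '' s) := by
    rw [image_image]
    exact image_congr fun a ha => (hfk a ha).symm
  rw [himg]
  refine LipschitzOnWith.euclideanHausdorffMeasure_image_le (LipschitzOnWith.of_dist_le_mul ?_) d
  rintro _ ⟨a, ha, rfl⟩ _ ⟨b, hb, rfl⟩
  simp only [Function.comp_apply, hfk a ha, hfk b hb]
  exact h a ha b hb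

end HausdorffComparison

namespace DiffusiveTransport

section Graph

open Module
open scoped Gradient ENNReal

variable {V E : Type*} [NormedAddCommGroup V] [InnerProductSpace ℝ V]
  [NormedAddCommGroup E] [InnerProductSpace ℝ E]

/-- `ι` identifies `V` with the hyperplane orthogonal to the unit vector `ν`. -/
structure IsHyperplaneFrame (ι : V →ₗᵢ[ℝ] E) (ν : E) : Prop where
  norm_eq_one : ‖ν‖ = 1
  inner_eq_zero : ∀ y, ⟪ν, ι y⟫ = 0
  exists_eq : ∀ x, ∃ y, x = ι y + ⟪ν, x⟫ • ν

/-- The graph map of `w` over the hyperplane `x₀ + range ι`, in the direction `ν`. -/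
def graphMap (ι : V →ₗᵢ[ℝ] E) (ν x₀ : E) (w : V → ℝ) (y : V) : E := x₀ + (ι y + w y • ν)

/-- The linear part of the graph map of a linear function with gradient `p`. -/
noncomputable def linearGraph (ι : V →ₗᵢ[ℝ] E) (ν : E) (p : V) : V →L[ℝ] E :=
  ι.toContinuousLinearMap + (innerSL ℝ p).smulRight ν

theorem linearGraph_apply (ι : V →ₗᵢ[ℝ] E) (ν : E) (p y : V) :
    linearGraph ι ν p y = ι y + ⟪p, y⟫ • ν := rfl

variable {ι : V →ₗᵢ[ℝ] E} {ν : E} (H : IsHyperplaneFrame ι ν)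
include H

theorem IsHyperplaneFrame.inner_self : ⟪ν, ν⟫ = 1 := by
  rw [real_inner_self_eq_norm_sq, H.norm_eq_one, one_pow]

theorem IsHyperplaneFrame.inner_add_add (y z : V) (a b : ℝ) :
    ⟪ι y + a • ν, ι z + b • ν⟫ = ⟪y, z⟫ + a * b := by
  have h := H.inner_eq_zero y
  rw [real_inner_comm] at h
  simp [inner_add_left, inner_add_right, inner_smul_left, inner_smul_right, H.inner_eq_zero, h,
    H.norm_eq_one, mul_comm]

theorem IsHyperplaneFrame.norm_add_sq (y : V) (a : ℝ) :
    ‖ι y + a • ν‖ ^ 2 = ‖y‖ ^ 2 + a ^ 2 := by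
  rw [← real_inner_self_eq_norm_sq, H.inner_add_add, real_inner_self_eq_norm_sq, pow_two a]

theorem IsHyperplaneFrame.norm_le_norm_add (y : V) (a : ℝ) : ‖y‖ ≤ ‖ι y + a • ν‖ := by
  refine le_of_sq_le_sq ?_ (norm_nonneg _) |>.trans_eq rfl
  rw [H.norm_add_sq]; nlinarith [sq_nonneg a]

/-- The Gram matrix of the images of an orthonormal basis is the identity plus a rank-one matrix,
whose determinant is `1 + ‖p‖ ^ 2`. -/
theorem normDet_linearGraph [FiniteDimensional ℝ V] (p : V) :
    (linearGraph ι ν p : V →ₗ[ℝ] E).normDet = √(1 + ‖p‖ ^ 2) := by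
  let b := stdOrthonormalBasis ℝ V
  have h := (linearGraph ι ν p : V →ₗ[ℝ] E).normDet_sq_eq_det_gram b
  have hg : Matrix.gram ℝ (fun i => (linearGraph ι ν p : V →ₗ[ℝ] E) (b i)) =
      1 + Matrix.replicateCol Unit (fun i => ⟪p, b i⟫) *
        Matrix.replicateRow Unit (fun i => ⟪p, b i⟫) := by
    ext i j
    rw [Matrix.gram_apply]
    simp only [ContinuousLinearMap.coe_coe, linearGraph_apply, H.inner_add_add,
      orthonormal_iff_ite.1 b.orthonormal, Matrix.add_apply, Matrix.one_apply, Matrix.mul_apply,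
      Matrix.replicateCol_apply, Matrix.replicateRow_apply, Finset.univ_unique, Finset.sum_const,
      Finset.card_singleton, one_smul]
  rw [hg, Matrix.det_one_add_replicateCol_mul_replicateRow] at h
  have hs : (fun i => ⟪p, b i⟫) ⬝ᵥ (fun i => ⟪p, b i⟫) = ‖p‖ ^ 2 := by
    rw [← b.sum_sq_inner_left p]
    simp [dotProduct, pow_two]
  rw [hs] at h
  rw [eq_comm, Real.sqrt_eq_iff_mul_self_eq (by positivity) (LinearMap.normDet_nonneg _), ← pow_two]
  simpa using h.symm

/-- The two chords differ by at most `ε ‖a - b‖`, and each chord is at least as long as `a - b`.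
This compares a graph with its linearization in both directions. -/
theorem IsHyperplaneFrame.dist_graphMap_le {x₀ : E} {w : V → ℝ} {p a b : V} {ε : ℝ}
    (hw : |w a - w b - ⟪p, a - b⟫| ≤ ε * ‖a - b‖) :
    dist (graphMap ι ν x₀ w a) (graphMap ι ν x₀ w b) ≤
      (1 + ε) * dist (linearGraph ι ν p a) (linearGraph ι ν p b) ∧
    dist (linearGraph ι ν p a) (linearGraph ι ν p b) ≤
      (1 + ε) * dist (graphMap ι ν x₀ w a) (graphMap ι ν x₀ w b) := by
  have h1 : graphMap ι ν x₀ w a - graphMap ι ν x₀ w b = ι (a - b) + (w a - w b) • ν := by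
    simp only [graphMap, map_sub]; module
  have h2 : linearGraph ι ν p a - linearGraph ι ν p b = ι (a - b) + ⟪p, a - b⟫ • ν := by
    rw [← map_sub, linearGraph_apply]
  have h3 : (ι (a - b) + (w a - w b) • ν) - (ι (a - b) + ⟪p, a - b⟫ • ν) =
      (w a - w b - ⟪p, a - b⟫) • ν := by module
  have h4 : ‖(w a - w b - ⟪p, a - b⟫) • ν‖ ≤ ε * ‖a - b‖ := by
    rwa [norm_smul, H.norm_eq_one, mul_one, Real.norm_eq_abs]
  have hε : 0 ≤ ε ∨ ‖a - b‖ = 0 := by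
    rcases (norm_nonneg (a - b)).eq_or_lt with h | h
    · exact .inr h.symm
    · exact .inl (nonneg_of_mul_nonneg_left ((abs_nonneg _).trans hw) h)
  have hmul : ∀ c : ℝ, ε * ‖a - b‖ ≤ ε * ‖ι (a - b) + c • ν‖ ∨ ‖a - b‖ = 0 := fun c =>
    hε.imp (fun h => mul_le_mul_of_nonneg_left (H.norm_le_norm_add _ _) h) id
  rcases eq_or_ne a b with rfl | hab
  · simp
  have hab' : ‖a - b‖ ≠ 0 := norm_ne_zero_iff.2 (sub_ne_zero.2 hab)
  rw [dist_eq_norm, dist_eq_norm, h1, h2]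
  rw [← h3, norm_sub_rev] at h4
  have k1 := norm_le_norm_add_norm_sub (ι (a - b) + ⟪p, a - b⟫ • ν) (ι (a - b) + (w a - w b) • ν)
  have k2 := norm_le_norm_add_norm_sub (ι (a - b) + (w a - w b) • ν) (ι (a - b) + ⟪p, a - b⟫ • ν)
  rw [norm_sub_rev] at k2
  have m1 := (hmul (w a - w b)).resolve_right hab'
  have m2 := (hmul ⟪p, a - b⟫).resolve_right hab'
  constructor <;> linarith

omit H in
theorem continuous_graphMap {x₀ : E} {w : V → ℝ} (hw : Continuous w) :
    Continuous (graphMap ι ν x₀ w) := by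
  unfold graphMap; fun_prop

theorem IsHyperplaneFrame.norm_sub_le_graphMap (x₀ : E) (w : V → ℝ) (y z : V) :
    ‖y - z‖ ≤ ‖graphMap ι ν x₀ w y - graphMap ι ν x₀ w z‖ := by
  have h1 : graphMap ι ν x₀ w y - graphMap ι ν x₀ w z = ι (y - z) + (w y - w z) • ν := by
    simp only [graphMap, map_sub]; module
  rw [h1]
  exact H.norm_le_norm_add _ _

theorem IsHyperplaneFrame.graphMap_injective (x₀ : E) (w : V → ℝ) :
    Function.Injective (graphMap ι ν x₀ w) := fun y z h => by
  have := H.norm_sub_le_graphMap x₀ w y z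
  rw [h, sub_self, norm_zero] at this
  exact sub_eq_zero.1 (norm_le_zero_iff.1 this)

theorem IsHyperplaneFrame.exists_lipschitzWith_graphMap (x₀ : E) {w : V → ℝ}
    (hw : ContDiff ℝ 1 w) (hc : HasCompactSupport w) :
    ∃ C : ℝ≥0, LipschitzWith C (graphMap ι ν x₀ w) := by
  obtain ⟨C, hC⟩ := hw.lipschitzWith_of_hasCompactSupport hc one_ne_zero
  refine ⟨1 + C, LipschitzWith.of_dist_le_mul fun a b => ?_⟩
  have h1 := (H.dist_graphMap_le (x₀ := x₀) (w := w) (p := 0) (a := a) (b := b) (ε := C) (by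
    have := hC.dist_le_mul a b
    rw [dist_eq_norm, dist_eq_norm, Real.norm_eq_abs] at this
    simpa using this)).1
  have h2 : dist (linearGraph ι ν 0 a) (linearGraph ι ν 0 b) = dist a b := by
    simp [linearGraph_apply]
  rw [h2] at h1
  exact h1

variable [FiniteDimensional ℝ V] [MeasurableSpace V] [BorelSpace V] [MeasurableSpace E] [BorelSpace E]

theorem IsHyperplaneFrame.measurableEmbedding_graphMap (x₀ : E) {w : V → ℝ} (hw : Continuous w) :
    MeasurableEmbedding (graphMap ι ν x₀ w) :=
  (continuous_graphMap hw).measurableEmbedding (H.graphMap_injective x₀ w)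

/-- The area formula for graphs. -/
theorem IsHyperplaneFrame.comap_graphMap (x₀ : E) {w : V → ℝ} (hw : ContDiff ℝ 1 w)
    (hc : HasCompactSupport w) :
    (μHE[finrank ℝ V] : Measure E).comap (graphMap ι ν x₀ w) =
      (volume : Measure V).withDensity fun y => ENNReal.ofReal √(1 + ‖∇ w y‖ ^ 2) := by
  have hme := H.measurableEmbedding_graphMap x₀ hw.continuous
  set d := finrank ℝ V
  set φ := graphMap ι ν x₀ w
  set m : Measure V := (μHE[d] : Measure E).comap φ
  have hm : ∀ s, m s = μHE[d] (φ '' s) := fun s => hme.comap_apply _ s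
  obtain ⟨C, hφ⟩ := H.exists_lipschitzWith_graphMap x₀ hw hc
  have hle : ∀ s, m s ≤ (C : ℝ≥0∞) ^ d * volume s := fun s => by
    rw [hm, ← InnerProductSpace.euclideanHausdorffMeasure_eq_volume (V := V)]
    exact hφ.lipschitzOnWith.euclideanHausdorffMeasure_image_le d
  have hac : m ≪ volume := fun s hs => by
    have := hle s
    rw [hs, mul_zero] at this
    exact nonpos_iff_eq_zero.1 this
  have hlf : IsLocallyFiniteMeasure m := ⟨fun x => ⟨Metric.closedBall x 1,
    Metric.closedBall_mem_nhds x one_pos, (hle _).trans_lt (ENNReal.mul_lt_top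
      (ENNReal.pow_lt_top ENNReal.coe_lt_top) measure_closedBall_lt_top)⟩⟩
  rw [← Measure.withDensity_rnDeriv_eq m volume hac]
  refine withDensity_congr_ae ?_
  -- By Besicovitch differentiation the density at almost every `y` is the limit of ratios over
  -- small balls, so it is enough to estimate these ratios.
  filter_upwards [Besicovitch.ae_tendsto_rnDeriv m volume] with y hy
  set L := m.rnDeriv volume y
  set p := ∇ w y
  set J := ENNReal.ofReal √(1 + ‖p‖ ^ 2)
  have hlin : ∀ s : Set V, μHE[d] (linearGraph ι ν p '' s) = J * volume s := fun s => by
    have := LinearMap.euclideanHausdorffMeasure_image_eq_normDet_mul_volume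
      (linearGraph ι ν p : V →ₗ[ℝ] E) s
    rw [normDet_linearGraph H] at this
    exact this
  have hstrict : HasStrictFDerivAt w (innerSL ℝ p) y := by
    have h := hw.contDiffAt.hasStrictFDerivAt (x := y) one_ne_zero
    have h2 := ((hw.differentiable one_ne_zero) y).hasGradientAt.hasFDerivAt.fderiv
    rw [h2] at h
    exact h
  have hvol : ∀ r > 0, volume (Metric.closedBall y r) ≠ 0 ∧ volume (Metric.closedBall y r) ≠ ⊤ :=
    fun r hr => ⟨(Metric.measure_closedBall_pos volume y hr).ne', measure_closedBall_lt_top.ne⟩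
  -- Strict differentiability makes `φ` and its linearization `(1 + ε)`-bi-Lipschitz equivalent on
  -- small balls, and the linear image has measure exactly `J` times the volume.
  have key : ∀ ε : ℝ≥0, 0 < ε → ∀ᶠ r in 𝓝[>] (0 : ℝ),
      m (Metric.closedBall y r) / volume (Metric.closedBall y r) ≤
        ((1 + ε : ℝ≥0) : ℝ≥0∞) ^ d * J ∧
      J ≤ ((1 + ε : ℝ≥0) : ℝ≥0∞) ^ d *
        (m (Metric.closedBall y r) / volume (Metric.closedBall y r)) := by
    intro ε hε
    have h1 := (hasStrictFDerivAt_iff_isLittleO.1 hstrict).def (NNReal.coe_pos.2 hε)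
    obtain ⟨r₀, hr₀, hball⟩ := Metric.eventually_nhds_iff_ball.1 h1
    filter_upwards [Ioo_mem_nhdsGT hr₀] with r hr
    have hest : ∀ a ∈ Metric.closedBall y r, ∀ b ∈ Metric.closedBall y r,
        |w a - w b - ⟪p, a - b⟫| ≤ ε * ‖a - b‖ := fun a ha b hb => by
      have := hball (a, b) (by
        rw [Metric.mem_ball, Prod.dist_eq]
        exact max_lt (ha.trans_lt hr.2) (hb.trans_lt hr.2))
      simpa using this
    obtain ⟨hv0, hvt⟩ := hvol r hr.1
    have e1 := euclideanHausdorffMeasure_image_le_of_dist_le (K := 1 + ε) (f := φ)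
      (g := linearGraph ι ν p) (fun a ha b hb => (H.dist_graphMap_le (hest a ha b hb)).1) d
    have e2 := euclideanHausdorffMeasure_image_le_of_dist_le (K := 1 + ε) (g := φ)
      (f := linearGraph ι ν p) (fun a ha b hb => (H.dist_graphMap_le (hest a ha b hb)).2) d
    rw [← hm, hlin] at e1 e2
    constructor
    · rw [ENNReal.div_le_iff hv0 hvt, mul_assoc]; exact e1
    · rw [← mul_div_assoc, ENNReal.le_div_iff_mul_le (.inl hv0) (.inl hvt)]; exact e2
  have hlim : Filter.Tendsto (fun ε : ℝ≥0 => ((1 + ε : ℝ≥0) : ℝ≥0∞) ^ d) (𝓝[>] 0) (𝓝 1) := by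
    have : Continuous fun ε : ℝ≥0 => ((1 + ε : ℝ≥0) : ℝ≥0∞) ^ d := by
      refine (ENNReal.continuous_pow d).comp (ENNReal.continuous_coe.comp (by fun_prop))
    have h := this.tendsto 0
    simp only [add_zero, ENNReal.coe_one, one_pow] at h
    exact h.mono_left nhdsWithin_le_nhds
  have hJt : J ≠ ⊤ := ENNReal.ofReal_ne_top
  have hLJ : ∀ ε : ℝ≥0, 0 < ε → L ≤ ((1 + ε : ℝ≥0) : ℝ≥0∞) ^ d * J := fun ε hε =>
    le_of_tendsto hy ((key ε hε).mono fun _ h => h.1)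
  have hJL : ∀ ε : ℝ≥0, 0 < ε → J ≤ ((1 + ε : ℝ≥0) : ℝ≥0∞) ^ d * L := fun ε hε =>
    ge_of_tendsto (ENNReal.Tendsto.const_mul hy (.inr (ENNReal.pow_ne_top ENNReal.coe_ne_top)))
      ((key ε hε).mono fun _ h => h.2)
  refine le_antisymm ?_ ?_
  · have := ge_of_tendsto (ENNReal.Tendsto.mul_const hlim (.inr hJt))
      (eventually_mem_nhdsWithin.mono fun ε hε => hLJ ε hε)
    simpa using this
  · have hLt : L ≠ ⊤ := ne_top_of_le_ne_top
      (ENNReal.mul_ne_top (ENNReal.pow_ne_top ENNReal.coe_ne_top) hJt) (hLJ 1 one_pos)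
    have := ge_of_tendsto (ENNReal.Tendsto.mul_const hlim (.inr hLt))
      (eventually_mem_nhdsWithin.mono fun ε hε => hJL ε hε)
    simpa using this

end Graph

end DiffusiveTransport

/-! ### Hypersurfaces as local graphs, and their unit normals. -/

namespace DiffusiveTransport

section Graph

open Module
open scoped Gradient ENNReal

theorem exists_isHyperplaneFrame {n : ℕ} (hn : 1 ≤ n) {ν : Space n} (hν : ‖ν‖ = 1) :
    ∃ ι : Space (n - 1) →ₗᵢ[ℝ] Space n, IsHyperplaneFrame ι ν := by
  obtain ⟨m, rfl⟩ : ∃ m, n = m + 1 := ⟨n - 1, by omega⟩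
  have : Fact (finrank ℝ (Space (m + 1)) = m + 1) := ⟨finrank_euclideanSpace_fin⟩
  have hν0 : ν ≠ 0 := norm_ne_zero_iff.1 (by rw [hν]; exact one_ne_zero)
  let b := OrthonormalBasis.fromOrthogonalSpanSingleton (𝕜 := ℝ) m hν0
  let ι : Space m →ₗᵢ[ℝ] Space (m + 1) :=
    ((ℝ ∙ ν)ᗮ).subtypeₗᵢ.comp b.repr.symm.toLinearIsometry
  refine ⟨ι, hν, fun y => ?_, fun x => ?_⟩
  · exact Submodule.mem_orthogonal_singleton_iff_inner_right.1 (b.repr.symm y).2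
  · have hx : x - ⟪ν, x⟫ • ν ∈ (ℝ ∙ ν)ᗮ := by
      rw [Submodule.mem_orthogonal_singleton_iff_inner_right, inner_sub_right, inner_smul_right,
        real_inner_self_eq_norm_sq, hν]
      ring
    refine ⟨b.repr ⟨_, hx⟩, ?_⟩
    have : ι (b.repr ⟨_, hx⟩) = x - ⟪ν, x⟫ • ν := by
      simp [ι]
    rw [this, sub_add_cancel]

variable {V E : Type*} [NormedAddCommGroup V] [InnerProductSpace ℝ V] [FiniteDimensional ℝ V]
  [NormedAddCommGroup E] [InnerProductSpace ℝ E] [FiniteDimensional ℝ E]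

/-- The coordinate along the hyperplane `range ι`. -/
noncomputable def frameProj (ι : V →ₗᵢ[ℝ] E) : E →L[ℝ] V :=
  ContinuousLinearMap.adjoint ι.toContinuousLinearMap

variable {ι : V →ₗᵢ[ℝ] E} {ν : E} (H : IsHyperplaneFrame ι ν)
include H

theorem IsHyperplaneFrame.frameProj_add (y : V) (a : ℝ) : frameProj ι (ι y + a • ν) = y := by
  refine ext_inner_left ℝ fun v => ?_
  rw [frameProj, ContinuousLinearMap.adjoint_inner_right]
  have h := H.inner_eq_zero v
  rw [real_inner_comm] at h
  simp [inner_add_right, inner_smul_right, h]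

theorem IsHyperplaneFrame.eq_frameProj_add (x : E) : x = ι (frameProj ι x) + ⟪ν, x⟫ • ν := by
  obtain ⟨y, hy⟩ := H.exists_eq x
  have : frameProj ι x = y := by
    conv_lhs => rw [hy]
    exact H.frameProj_add y _
  rw [this]; exact hy

omit [FiniteDimensional ℝ V] [FiniteDimensional ℝ E] in
theorem IsHyperplaneFrame.inner_add (y : V) (a : ℝ) : ⟪ν, ι y + a • ν⟫ = a := by
  rw [inner_add_right, inner_smul_right, H.inner_eq_zero, H.inner_self]; ring

theorem IsHyperplaneFrame.mem_range_graphMap {x₀ : E} {w : V → ℝ} {x : E} :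
    x ∈ range (graphMap ι ν x₀ w) ↔ w (frameProj ι (x - x₀)) = ⟪ν, x - x₀⟫ := by
  constructor
  · rintro ⟨y, rfl⟩
    have : graphMap ι ν x₀ w y - x₀ = ι y + w y • ν := by simp [graphMap]
    rw [this, H.frameProj_add, H.inner_add]
  · intro h
    refine ⟨frameProj ι (x - x₀), ?_⟩
    rw [graphMap, h, ← H.eq_frameProj_add]; abel

omit [FiniteDimensional ℝ V] [FiniteDimensional ℝ E] H in
theorem hasFDerivAt_graphMap (x₀ : E) [CompleteSpace V] {w : V → ℝ} {y : V}
    (hw : DifferentiableAt ℝ w y) :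
    HasFDerivAt (graphMap ι ν x₀ w) (linearGraph ι ν (∇ w y)) y := by
  have h1 : HasFDerivAt w (innerSL ℝ (∇ w y)) y := hw.hasGradientAt.hasFDerivAt
  exact (ι.toContinuousLinearMap.hasFDerivAt.add (h1.smul_const ν)).const_add x₀

/-- The zero set of a `C¹` function is locally a graph over its tangent plane. -/
theorem IsHyperplaneFrame.exists_graph {g : E → ℝ} {p : E} (hg : ContDiffAt ℝ 1 g p)
    (hp : g p = 0) {c : ℝ} (hc : c ≠ 0) (hν : ∇ g p = c • ν) :
    ∃ w : V → ℝ, ContDiff ℝ 1 w ∧ HasCompactSupport w ∧ w 0 = 0 ∧ ∇ w 0 = 0 ∧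
      ∀ᶠ x in 𝓝 p, g x = 0 ↔ x ∈ range (graphMap ι ν p w) := by
  have hgd : ∀ x, fderiv ℝ g p x = c * ⟪ν, x⟫ := fun x => by
    rw [← inner_gradient_left, hν, inner_smul_left]; rfl
  let A : V × ℝ →L[ℝ] E := ι.toContinuousLinearMap.comp (ContinuousLinearMap.fst ℝ V ℝ) +
    (ContinuousLinearMap.snd ℝ V ℝ).smulRight ν
  let f : V × ℝ → ℝ := fun q => g (p + A q)
  have hA : ∀ y a, A (y, a) = ι y + a • ν := fun y a => rfl
  have hA0 : p + A 0 = p := by rw [map_zero, add_zero]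
  have hf : ContDiffAt ℝ 1 f 0 := by
    refine ContDiffAt.comp (g := g) 0 (by rwa [hA0]) ?_
    exact contDiffAt_const.add A.contDiff.contDiffAt
  have hdf : fderiv ℝ f 0 = (fderiv ℝ g p).comp A := by
    have h1 : HasFDerivAt g (fderiv ℝ g p) (p + A 0) := by
      rw [hA0]; exact (hg.differentiableAt one_ne_zero).hasFDerivAt
    exact (h1.comp 0 (A.hasFDerivAt.const_add p)).fderiv
  -- The derivative in the direction `ν` is multiplication by `c ≠ 0`, which is what the implicit
  -- function theorem requires. The tangential derivative vanishes, whence `∇ w 0 = 0`.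
  have hinr : fderiv ℝ f 0 ∘L .inr ℝ V ℝ =
      (ContinuousLinearEquiv.unitsEquivAut ℝ (Units.mk0 c hc) : ℝ →L[ℝ] ℝ) := by
    ext
    simp [hdf, hA, hgd, H.norm_eq_one]
  have hinl : fderiv ℝ f 0 ∘L .inl ℝ V ℝ = 0 := by
    ext y
    simp [hdf, hA, hgd, H.inner_eq_zero]
  have hinv : (fderiv ℝ f 0 ∘L .inr ℝ V ℝ).IsInvertible := by
    rw [hinr]; exact ContinuousLinearMap.isInvertible_equiv
  set ψ := hf.implicitFunction one_ne_zero hinv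
  have hψc : ContDiffAt ℝ 1 ψ 0 := hf.contDiffAt_implicitFunction one_ne_zero hinv
  have hψ0 : ψ 0 = 0 := hf.implicitFunction_apply_self one_ne_zero hinv
  have hψd : HasFDerivAt ψ (0 : V →L[ℝ] ℝ) 0 := by
    have := (hf.hasStrictFDerivAt_implicitFunction one_ne_zero hinv).hasFDerivAt
    rw [hinl, ContinuousLinearMap.comp_zero, neg_zero] at this
    exact this
  have hψe := hf.eventually_apply_eq_iff_implicitFunction one_ne_zero hinv
  obtain ⟨w, hw, hwc, hwψ⟩ := exists_contDiff_hasCompactSupport_eventuallyEq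
    (isCompact_singleton (x := (0 : V))) (f := ψ) (by rintro _ rfl; exact hψc)
  have hwψ0 := hwψ 0 rfl
  refine ⟨w, hw, hwc, by rw [hwψ0.self_of_nhds, hψ0], ?_, ?_⟩
  · rw [gradient, (hψd.congr_of_eventuallyEq hwψ0).fderiv, map_zero]
  · let k : E → V × ℝ := fun x => (frameProj ι (x - p), ⟪ν, x - p⟫)
    have hk : Continuous k := by fun_prop
    have hk0 : k p = 0 := by simp [k]
    have hkt : Filter.Tendsto k (𝓝 p) (𝓝 0) := by
      have := hk.tendsto p
      rwa [hk0] at this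
    have hkt1 : Filter.Tendsto (fun x => (k x).1) (𝓝 p) (𝓝 0) :=
      (continuous_fst.tendsto (0 : V × ℝ)).comp hkt
    filter_upwards [hkt.eventually hψe, hkt1.eventually hwψ0] with x hx1 hx2
    rw [H.mem_range_graphMap]
    have h3 : f (k x) = g x := by
      change g (p + A (k x)) = g x
      rw [hA, ← H.eq_frameProj_add]; congr 1; abel
    have h4 : f 0 = 0 := by
      change g (p + A 0) = 0
      rw [hA0, hp]
    rw [h3, h4] at hx1
    rw [hx1]
    change ψ (k x).1 = (k x).2 ↔ w (k x).1 = (k x).2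
    rw [hx2]

omit [FiniteDimensional ℝ V] [FiniteDimensional ℝ E] in
theorem IsHyperplaneFrame.norm_sub_sq (p : V) : ‖ν - ι p‖ ^ 2 = 1 + ‖p‖ ^ 2 := by
  have h : ν - ι p = ι (-p) + (1 : ℝ) • ν := by rw [map_neg, one_smul]; abel
  rw [h, H.norm_add_sq, norm_neg]; ring

omit [FiniteDimensional ℝ V] [FiniteDimensional ℝ E] in
/-- A unit vector orthogonal to the tangent space of a graph is a multiple of `ν - ι p`. -/
theorem IsHyperplaneFrame.inner_apply_of_orthogonal {p : V} {μ : E} (hμ : ‖μ‖ = 1)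
    (h : ∀ v, ⟪μ, linearGraph ι ν p v⟫ = 0) (T : E →L[ℝ] E) :
    ⟪μ, T μ⟫ = ⟪ν - ι p, T (ν - ι p)⟫ / (1 + ‖p‖ ^ 2) := by
  obtain ⟨a, ha⟩ := H.exists_eq μ
  set c := ⟪ν, μ⟫
  have hac : a = -c • p := by
    refine ext_inner_right ℝ fun v => ?_
    have := h v
    rw [ha, linearGraph_apply, H.inner_add_add] at this
    rw [inner_smul_left]
    simp only [conj_trivial]
    linarith
  have hμc : μ = c • (ν - ι p) := by
    rw [ha, hac, map_smul]; module
  have hc : c ^ 2 * (1 + ‖p‖ ^ 2) = 1 := by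
    rw [← H.norm_sub_sq, ← sq_abs c, ← Real.norm_eq_abs, ← mul_pow, ← norm_smul, ← hμc, hμ, one_pow]
  rw [hμc, map_smul, inner_smul_left, inner_smul_right, eq_div_iff (by positivity)]
  simp only [conj_trivial]
  linear_combination ⟪ν - ι p, T (ν - ι p)⟫ * hc

end Graph

section Normal

open scoped Gradient

variable {n : ℕ}

/-- The derivative of `g` maps the tangent cone of `M` into that of `{0}`, which is trivial because
the point is isolated. -/
theorem isUnitNormal_of_subset_zeroSet {M : Set (Space n)} {p : Space n} {g : Space n → ℝ}
    (hg : DifferentiableAt ℝ g p) (hp : g p = 0) (hM : ∀ᶠ x in 𝓝 p, x ∈ M → g x = 0)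
    {ν : Space n} (hν : ‖ν‖ = 1) {c : ℝ} (hc : c ≠ 0) (hgν : ∇ g p = c • ν) :
    IsUnitNormal M p ν := by
  refine ⟨hν, fun u hu => ?_⟩
  rw [← tangentConeAt_inter_nhds hM] at hu
  have h := hg.hasFDerivAt.hasFDerivWithinAt (s := M ∩ {x | x ∈ M → g x = 0})
    |>.mapsTo_tangent_cone hu
  have h0 : fderiv ℝ g p u ∈ ({0} : Set ℝ) := by
    refine tangentConeAt_subset_zero (𝕜 := ℝ) (x := g p) (s := {0}) ?_ (tangentConeAt_mono ?_ h)
    · rw [hp, accPt_iff_nhds]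
      push Not
      exact ⟨univ, Filter.univ_mem, by simp⟩
    · rintro _ ⟨x, ⟨hx, hx'⟩, rfl⟩
      exact hx' hx
  rw [← inner_gradient_left, hgν, inner_smul_left] at h0
  exact (mul_eq_zero.1 (mem_singleton_iff.1 h0)).resolve_left hc

/-- The gradient direction of a defining function. -/
theorem exists_unit_gradient {g : Space n → ℝ} {p : Space n} (h : fderiv ℝ g p ≠ 0) :
    ∃ ν : Space n, ‖ν‖ = 1 ∧ ∃ c : ℝ, c ≠ 0 ∧ ∇ g p = c • ν := by
  have h0 : ∇ g p ≠ 0 := fun h' => h (by rw [← toDual_gradient, h', map_zero])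
  have hn : ‖∇ g p‖ ≠ 0 := norm_ne_zero_iff.2 h0
  exact ⟨‖∇ g p‖⁻¹ • ∇ g p, norm_smul_inv_norm h0, ‖∇ g p‖, hn, by rw [smul_inv_smul₀ hn]⟩

/-- Near each of its points, a hypersurface lies in the zero set of a `C¹` submersion. -/
theorem IsHypersurface.exists_defining {M : Set (Space n)} (hM : IsHypersurface M) {p : Space n}
    (hp : p ∈ M) : ∃ g : Space n → ℝ, ContDiffAt ℝ 1 g p ∧ fderiv ℝ g p ≠ 0 ∧
      ∀ᶠ x in 𝓝 p, x ∈ M → g x = 0 := by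
  rcases hM.locally_flat p hp with ⟨-, g, hg, hg', h⟩ | ⟨-, g, b, hg, -, hli, -, h⟩
  · exact ⟨g, hg, hg', h.mono fun x hx => hx.1⟩
  · exact ⟨g, hg, hli.ne_zero 0, h.mono fun x hx h' => (hx.1 h').1⟩

theorem IsHypersurface.isUnitNormal_unitNormal {M : Set (Space n)} (hM : IsHypersurface M)
    {p : Space n} (hp : p ∈ M) : IsUnitNormal M p (unitNormal M p) := by
  obtain ⟨g, hg, hg', h⟩ := hM.exists_defining hp
  obtain ⟨ν, hν, c, hc, hgν⟩ := exists_unit_gradient hg'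
  have hex : ∃ ν, IsUnitNormal M p ν := ⟨ν, isUnitNormal_of_subset_zeroSet
    (hg.differentiableAt one_ne_zero) (h.self_of_nhds hp) h hν hc hgν⟩
  rw [unitNormal, dif_pos hex]
  exact hex.choose_spec

/-- The transport density on a graph. -/
theorem IsHyperplaneFrame.inner_of_isUnitNormal {m : ℕ} {ι : Space m →ₗᵢ[ℝ] Space n}
    {ν : Space n} (H : IsHyperplaneFrame ι ν) {M : Set (Space n)} {x₀ : Space n}
    {w : Space m → ℝ} {y : Space m} (hw : DifferentiableAt ℝ w y)
    (hM : ∀ᶠ z in 𝓝 y, graphMap ι ν x₀ w z ∈ M) {μ : Space n}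
    (hμ : IsUnitNormal M (graphMap ι ν x₀ w y) μ) (T : Space n →L[ℝ] Space n) :
    ⟪μ, T μ⟫ = ⟪ν - ι (∇ w y), T (ν - ι (∇ w y))⟫ / (1 + ‖∇ w y‖ ^ 2) := by
  refine H.inner_apply_of_orthogonal hμ.1 (fun v => hμ.2 _ ?_) T
  have hv : v ∈ tangentConeAt ℝ {z | graphMap ι ν x₀ w z ∈ M} y := by
    rw [tangentConeAt_of_mem_nhds hM]; trivial
  have h := (hasFDerivAt_graphMap (ι := ι) (ν := ν) x₀ hw).hasFDerivWithinAt.mapsTo_tangent_cone hv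
  exact tangentConeAt_mono (image_subset_iff.2 fun z hz => hz) h

end Normal

end DiffusiveTransport

/-! ### Area of a hypersurface and density of its interior points. -/

namespace DiffusiveTransport

open scoped Gradient

variable {n : ℕ}

theorem graphMap_zero {V E : Type*} [NormedAddCommGroup V] [InnerProductSpace ℝ V]
    [NormedAddCommGroup E] [InnerProductSpace ℝ E] {ι : V →ₗᵢ[ℝ] E} {ν x₀ : E} {w : V → ℝ}
    (hw : w 0 = 0) : graphMap ι ν x₀ w 0 = x₀ := by
  simp [graphMap, hw]

theorem euclideanHausdorffMeasure_graphMap_image_lt_top {ι : Space (n - 1) →ₗᵢ[ℝ] Space n}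
    {ν : Space n} (H : IsHyperplaneFrame ι ν) (x₀ : Space n) {w : Space (n - 1) → ℝ}
    (hw : ContDiff ℝ 1 w) (hc : HasCompactSupport w) {s : Set (Space (n - 1))}
    (hs : Bornology.IsBounded s) : μHE[n - 1] (graphMap ι ν x₀ w '' s) < ⊤ := by
  obtain ⟨C, hC⟩ := H.exists_lipschitzWith_graphMap x₀ hw hc
  refine (hC.lipschitzOnWith.euclideanHausdorffMeasure_image_le (s := s) (n - 1)).trans_lt ?_
  rw [EuclideanSpace.euclideanHausdorffMeasure_eq_volume]
  exact ENNReal.mul_lt_top (ENNReal.pow_lt_top ENNReal.coe_lt_top) hs.measure_lt_top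

theorem volume_le_euclideanHausdorffMeasure_graphMap_image {ι : Space (n - 1) →ₗᵢ[ℝ] Space n}
    {ν : Space n} (H : IsHyperplaneFrame ι ν) (x₀ : Space n) (w : Space (n - 1) → ℝ)
    (s : Set (Space (n - 1))) : volume s ≤ μHE[n - 1] (graphMap ι ν x₀ w '' s) := by
  have := euclideanHausdorffMeasure_image_le_of_dist_le (K := 1) (f := id)
    (g := graphMap ι ν x₀ w) (s := s) (fun a _ b _ => by
      rw [dist_eq_norm, dist_eq_norm, NNReal.coe_one, one_mul]
      exact H.norm_sub_le_graphMap x₀ w a b) (n - 1)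
  simpa [EuclideanSpace.euclideanHausdorffMeasure_eq_volume] using this

/-- A hypersurface has finite area. -/
theorem IsHypersurface.measure_lt_top (hn : 1 ≤ n) {M : Set (Space n)} (hM : IsHypersurface M) :
    μHE[n - 1] M < ⊤ := by
  refine hM.isCompact.measure_lt_top_of_nhdsWithin fun p hp => ?_
  obtain ⟨g, hg, hg', h⟩ := hM.exists_defining hp
  obtain ⟨ν, hν, c, hc, hgν⟩ := exists_unit_gradient hg'
  obtain ⟨ι, H⟩ := exists_isHyperplaneFrame hn hν
  obtain ⟨w, hw, hwc, -, -, hgr⟩ := H.exists_graph hg (h.self_of_nhds hp) hc hgν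
  have hN : {x | (x ∈ M → g x = 0) ∧ (g x = 0 ↔ x ∈ range (graphMap ι ν p w))} ∩
      Metric.closedBall p 1 ∈ 𝓝 p :=
    Filter.inter_mem (h.and hgr) (Metric.closedBall_mem_nhds p one_pos)
  refine ⟨_, inter_mem_nhdsWithin M hN, ?_⟩
  -- The graph map does not decrease distances, so the parameters of a bounded piece are bounded.
  have hb : Bornology.IsBounded (graphMap ι ν p w ⁻¹' Metric.closedBall p 1) := by
    refine Metric.isBounded_iff.2 ⟨2, fun y hy z hz => ?_⟩
    rw [dist_eq_norm]
    refine (H.norm_sub_le_graphMap p w y z).trans ?_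
    rw [← dist_eq_norm]
    refine (dist_triangle_right _ _ p).trans ?_
    have h1 : dist (graphMap ι ν p w y) p ≤ 1 := hy
    have h2 : dist (graphMap ι ν p w z) p ≤ 1 := hz
    linarith
  refine (measure_mono ?_).trans_lt
    (euclideanHausdorffMeasure_graphMap_image_lt_top H p hw hwc hb)
  rintro x ⟨hxM, ⟨hx1, hx2⟩, hx3⟩
  obtain ⟨y, rfl⟩ := hx2.1 (hx1 hxM)
  exact ⟨y, hx3, rfl⟩

theorem IsInteriorPoint.exists_graph (hn : 1 ≤ n) {M : Set (Space n)} {p : Space n}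
    (hp : IsInteriorPoint M p) :
    ∃ (ν : Space n) (ι : Space (n - 1) →ₗᵢ[ℝ] Space n) (w : Space (n - 1) → ℝ),
      IsHyperplaneFrame ι ν ∧ ContDiff ℝ 1 w ∧ HasCompactSupport w ∧ w 0 = 0 ∧ ∇ w 0 = 0 ∧
      ∀ᶠ x in 𝓝 p, x ∈ M ↔ x ∈ range (graphMap ι ν p w) := by
  obtain ⟨hpM, g, hg, hg', h⟩ := hp
  obtain ⟨ν, hν, c, hc, hgν⟩ := exists_unit_gradient hg'
  obtain ⟨ι, H⟩ := exists_isHyperplaneFrame hn hν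
  obtain ⟨w, hw, hwc, hw0, hw1, hgr⟩ := H.exists_graph hg (h.self_of_nhds.1 hpM) hc hgν
  refine ⟨ν, ι, w, H, hw, hwc, hw0, hw1, ?_⟩
  filter_upwards [h, hgr] with x h1 h2
  exact h1.trans h2

theorem IsInteriorPoint.eventually {M : Set (Space n)} {p : Space n} (hp : IsInteriorPoint M p) :
    ∀ᶠ x in 𝓝 p, x ∈ M → IsInteriorPoint M x := by
  obtain ⟨hpM, g, hg, hg', h⟩ := hp
  have h1 : ∀ᶠ x in 𝓝 p, ContDiffAt ℝ 1 g x := hg.eventually (by simp)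
  have h2 : ∀ᶠ x in 𝓝 p, fderiv ℝ g x ≠ 0 :=
    (hg.continuousAt_fderiv one_ne_zero).eventually_ne hg'
  filter_upwards [h1, h2, h.eventually_nhds] with x hx1 hx2 hx3 hxM
  exact ⟨hxM, g, hx1, hx2, hx3⟩

/-- Interior points are dense in a hypersurface. -/
theorem IsHypersurface.frequently_isInteriorPoint (hn : 1 ≤ n) {M : Set (Space n)}
    (hM : IsHypersurface M) {p : Space n} (hp : p ∈ M) : ∃ᶠ x in 𝓝 p, IsInteriorPoint M x := by
  rcases hM.locally_flat p hp with h | ⟨-, g, b, hg, hb, hli, hb0, h⟩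
  · intro h'
    exact h'.self_of_nhds h
  have hg' : fderiv ℝ g p ≠ 0 := hli.ne_zero 0
  obtain ⟨ν, hν, c, hc, hgν⟩ := exists_unit_gradient hg'
  obtain ⟨ι, H⟩ := exists_isHyperplaneFrame hn hν
  obtain ⟨w, hw, hwc, hw0, hw1, hgr⟩ := H.exists_graph hg (h.self_of_nhds.1 hp).1 hc hgν
  have hgd : ∀ x, fderiv ℝ g p x = c * ⟪ν, x⟫ := fun x => by
    rw [← inner_gradient_left, hgν, inner_smul_left]; rfl
  -- Some tangential direction points into the surface: if the derivative of `b` vanished on the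
  -- tangent plane, it would be proportional to that of `g`. Moving along the graph in this
  -- direction makes `b` positive.
  obtain ⟨v, hv⟩ : ∃ v, 0 < fderiv ℝ b p (ι v) := by
    by_contra hcon
    push Not at hcon
    have hz : ∀ v, fderiv ℝ b p (ι v) = 0 := fun v => by
      refine le_antisymm (hcon v) ?_
      have := hcon (-v)
      rw [map_neg, map_neg] at this
      linarith
    have hlin := LinearIndependent.pair_iff.1 hli (fderiv ℝ b p ν) (-c) (by
      ext x
      obtain ⟨y, hy⟩ := H.exists_eq x
      have : fderiv ℝ b p x = ⟪ν, x⟫ * fderiv ℝ b p ν := by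
        conv_lhs => rw [hy]
        rw [map_add, hz, map_smul, zero_add, smul_eq_mul]
      simp [hgd, this]
      ring)
    exact hc (neg_eq_zero.1 hlin.2)
  set φ := graphMap ι ν p w
  have hφ0 : φ 0 = p := graphMap_zero hw0
  have hφd : HasFDerivAt φ (linearGraph ι ν (∇ w 0)) 0 :=
    hasFDerivAt_graphMap p (hw.differentiable one_ne_zero 0)
  have hbd : HasDerivAt (fun t : ℝ => b (φ (t • v))) (fderiv ℝ b p (ι v)) 0 := by
    have h1 : HasFDerivAt b (fderiv ℝ b p) (φ 0) := by
      rw [hφ0]; exact (hb.differentiableAt one_ne_zero).hasFDerivAt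
    have h2 : HasDerivAt (fun t : ℝ => t • v) v 0 := by
      simpa using (hasDerivAt_id (0 : ℝ)).smul_const v
    have h3 := ((h1.comp 0 hφd).comp_hasDerivAt_of_eq 0 h2 (by simp))
    refine h3.congr_deriv ?_
    simp [hw1, linearGraph_apply]
  have hpos : ∀ᶠ t in 𝓝[>] (0 : ℝ), 0 < b (φ (t • v)) := by
    have := hasDerivWithinAt_iff_tendsto_slope.1 (hbd.hasDerivWithinAt (s := Ioi 0))
    rw [sdiff_singleton_eq_self (by simp)] at this
    have hev := this.eventually_const_lt hv
    filter_upwards [hev, self_mem_nhdsWithin] with t ht ht0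
    rw [slope_def_field] at ht
    simp only [zero_smul, hφ0, hb0, sub_zero] at ht
    exact (div_pos_iff_of_pos_right ht0).1 ht
  have hγ : Filter.Tendsto (fun t : ℝ => φ (t • v)) (𝓝[>] 0) (𝓝 p) := by
    have : Continuous fun t : ℝ => φ (t • v) :=
      (continuous_graphMap hw.continuous).comp (by fun_prop)
    have h := this.tendsto 0
    rw [zero_smul, hφ0] at h
    exact h.mono_left nhdsWithin_le_nhds
  have h1 : ∀ᶠ x in 𝓝 p, ContDiffAt ℝ 1 g x := hg.eventually (by simp)
  have h2 : ∀ᶠ x in 𝓝 p, fderiv ℝ g x ≠ 0 :=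
    (hg.continuousAt_fderiv one_ne_zero).eventually_ne hg'
  have h3 : ∀ᶠ x in 𝓝 p, ContDiffAt ℝ 1 b x := hb.eventually (by simp)
  refine hγ.frequently (Filter.Eventually.frequently ?_)
  filter_upwards [hpos, hγ.eventually h1, hγ.eventually h2, hγ.eventually h3,
    hγ.eventually h.eventually_nhds, hγ.eventually hgr] with t hb1 hg1 hg2 hb2 hM1 hgr1
  have hbc : ∀ᶠ x in 𝓝 (φ (t • v)), 0 < b x :=
    hb2.continuousAt.eventually (lt_mem_nhds hb1)
  refine ⟨hM1.self_of_nhds.2 ⟨hgr1.2 (mem_range_self _), hb1.le⟩, g, hg1, hg2, ?_⟩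
  filter_upwards [hM1, hbc] with x hx1 hx2
  rw [hx1]
  exact and_iff_left hx2.le

theorem IsInteriorPoint.measure_pos (hn : 1 ≤ n) {M : Set (Space n)} {p : Space n}
    (hp : IsInteriorPoint M p) : 0 < μHE[n - 1] M := by
  obtain ⟨ν, ι, w, H, hw, -, hw0, -, h⟩ := hp.exists_graph hn
  have hφ0 : graphMap ι ν p w 0 = p := graphMap_zero hw0
  have hN : {y | graphMap ι ν p w y ∈ M} ∈ 𝓝 0 := by
    have := (continuous_graphMap (ι := ι) (ν := ν) (x₀ := p) hw.continuous).tendsto 0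
    rw [hφ0] at this
    filter_upwards [this.eventually h] with y hy
    exact hy.2 (mem_range_self _)
  refine (Measure.measure_pos_of_mem_nhds volume hN).trans_le
    ((volume_le_euclideanHausdorffMeasure_graphMap_image H p w _).trans (measure_mono ?_))
  rintro _ ⟨y, hy, rfl⟩
  exact hy

theorem IsHypersurface.measure_pos (hn : 1 ≤ n) {M : Set (Space n)} (hM : IsHypersurface M)
    (hne : M.Nonempty) : 0 < μHE[n - 1] M := by
  obtain ⟨p, hp⟩ := hne
  obtain ⟨q, hq⟩ := (hM.frequently_isInteriorPoint hn hp).exists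
  exact hq.measure_pos hn

/-- If the transport density is constant, then the constant is the value of the functional. -/
theorem IsHypersurface.transportFunctional_eq (hn : 1 ≤ n) {M : Set (Space n)}
    (hM : IsHypersurface M) (hne : M.Nonempty) {T : Space n → Space n →L[ℝ] Space n} {c : ℝ}
    (hc : ∀ p ∈ M, ∀ ν, IsUnitNormal M p ν → ⟪ν, T p ν⟫ = c) : transportFunctional T M = c := by
  rw [transportFunctional, setIntegral_congr_fun hM.isCompact.measurableSet
    (g := fun _ => c) fun p hp => hc p hp _ (hM.isUnitNormal_unitNormal hp), setIntegral_const,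
    smul_eq_mul, mul_div_cancel_left₀]
  exact (ENNReal.toReal_pos (hM.measure_pos hn hne).ne' (hM.measure_lt_top hn).ne).ne'

end DiffusiveTransport

/-! ### Oscillating test functions with negative energy. -/

namespace DiffusiveTransport

open Module
open scoped Gradient

section TestFunction

variable {V E : Type*} [NormedAddCommGroup V] [InnerProductSpace ℝ V] [FiniteDimensional ℝ V]
  [NormedAddCommGroup E] [InnerProductSpace ℝ E] [FiniteDimensional ℝ E]

omit [FiniteDimensional ℝ E] in
-- In an orthonormal basis made of `ν` and a basis of the hyperplane, `ν` contributes nothing to the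
-- trace, so some tangential diagonal entry is negative.
theorem IsHyperplaneFrame.exists_inner_neg_of_trace_neg {ι : V →ₗᵢ[ℝ] E} {ν : E}
    (H : IsHyperplaneFrame ι ν) {A : E →L[ℝ] E} (hν : ⟪ν, A ν⟫ = 0)
    (hA : LinearMap.trace ℝ E (A : E →ₗ[ℝ] E) < 0) : ∃ e : V, ⟪ι e, A (ι e)⟫ < 0 := by
  let b := stdOrthonormalBasis ℝ V
  let f : Option (Fin (finrank ℝ V)) → E := fun o => o.elim ν fun i => ι (b i)
  have hf : Orthonormal ℝ f := by
    rw [orthonormal_iff_ite]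
    rintro (_ | i) (_ | j)
    · simp [f, H.norm_eq_one]
    · simp [f, H.inner_eq_zero]
    · simp only [f, Option.elim]
      rw [real_inner_comm, H.inner_eq_zero]; simp
    · simp only [f, Option.elim, LinearIsometry.inner_map_map, orthonormal_iff_ite.1 b.orthonormal,
        Option.some.injEq]
  have hsp : ⊤ ≤ Submodule.span ℝ (range f) := fun x _ => by
    obtain ⟨y, hy⟩ := H.exists_eq x
    rw [hy, ← b.sum_repr y, map_sum]
    refine Submodule.add_mem _ (Submodule.sum_mem _ fun i _ => ?_)
      (Submodule.smul_mem _ _ (Submodule.subset_span ⟨none, rfl⟩))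
    rw [map_smul]
    exact Submodule.smul_mem _ _ (Submodule.subset_span ⟨some i, rfl⟩)
  let B := OrthonormalBasis.mk hf hsp
  rw [LinearMap.trace_eq_sum_inner _ B, Fintype.sum_option] at hA
  simp only [B, OrthonormalBasis.coe_mk, f, Option.elim, ContinuousLinearMap.coe_coe, hν,
    zero_add] at hA
  obtain ⟨i, -, hi⟩ := Finset.exists_lt_of_sum_lt (g := fun _ => (0 : ℝ)) (by simpa using hA)
  exact ⟨b i, hi⟩

theorem eq_zero_of_gradient {F : Type*} [NormedAddCommGroup F] [InnerProductSpace ℝ F]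
    [CompleteSpace F] {u : F → ℝ} {R : ℝ} (hu : ∀ x, R < ‖x‖ → u x = 0) {x : F} (hx : R < ‖x‖) :
    ∇ u x = 0 := by
  have h : u =ᶠ[𝓝 x] fun _ => 0 := by
    filter_upwards [(isOpen_lt continuous_const continuous_norm).mem_nhds hx] with y hy
    exact hu y hy
  rw [gradient, h.fderiv_eq]
  simp

theorem continuous_gradient {F : Type*} [NormedAddCommGroup F] [InnerProductSpace ℝ F]
    [CompleteSpace F] {u : F → ℝ} (hu : ContDiff ℝ 1 u) : Continuous (∇ u) :=
  (InnerProductSpace.toDual ℝ F).symm.continuous.comp (hu.continuous_fderiv one_ne_zero)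

variable [MeasurableSpace V] [BorelSpace V]

theorem integrable_of_eq_zero_of_norm {F : V → ℝ} (hF : Continuous F) {R : ℝ}
    (h0 : ∀ z, R < ‖z‖ → F z = 0) : Integrable F :=
  hF.integrable_of_hasCompactSupport <| HasCompactSupport.intro (isCompact_closedBall 0 R)
    fun z hz => h0 z (by simpa using hz)

/-- A highly oscillating function whose gradients average a quadratic form that is negative
somewhere to a negative number. -/
theorem IsHyperplaneFrame.exists_testFunction {ι : V →ₗᵢ[ℝ] E} {ν : E}
    (H : IsHyperplaneFrame ι ν) (A : E →L[ℝ] E) {e : V} (he : ⟪ι e, A (ι e)⟫ < 0) :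
    ∃ u : E → ℝ, ContDiff ℝ ∞ u ∧ (∀ x, 1 / 2 < ‖x‖ → u x = 0) ∧
      ∫ z, ⟪ι (frameProj ι (∇ u (ι z))), A (ι (frameProj ι (∇ u (ι z))))⟫ < 0 := by
  let χ : ContDiffBump (0 : E) := ⟨1 / 4, 1 / 2, by norm_num, by norm_num⟩
  have hχc : ContDiff ℝ ∞ χ := χ.contDiff
  have hχ0 : ∀ x, 1 / 2 < ‖x‖ → χ x = 0 := fun x hx =>
    χ.zero_of_le_dist (by rw [dist_zero_right]; exact hx.le)
  let P : V → V := fun z => frameProj ι (∇ χ (ι z))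
  have hPc : Continuous P := (frameProj ι).continuous.comp
    ((continuous_gradient (hχc.of_le (by simp))).comp ι.continuous)
  have hP0 : ∀ z, 1 / 2 < ‖z‖ → P z = 0 := fun z hz => by
    simp only [P]
    rw [eq_zero_of_gradient hχ0 (by rwa [ι.norm_map]), map_zero]
  let B : V → V → ℝ := fun p q => ⟪ι p, A (ι q)⟫
  have hB : ∀ a b p q r, B (a • p - b • q) r = a * B p r - b * B q r := fun a b p q r => by
    simp only [B, map_sub, map_smul, inner_sub_left, inner_smul_left, conj_trivial]
  have hB' : ∀ a b p q r, B r (a • p - b • q) = a * B r p - b * B r q := fun a b p q r => by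
    simp only [B, map_sub, map_smul, inner_sub_right, inner_smul_right]
  let I := ∫ z, χ (ι z) ^ 2
  let J := ∫ z, B (P z) (P z)
  have hχι : Continuous fun z => χ (ι z) := χ.continuous.comp ι.continuous
  have hχι0 : ∀ z, 1 / 2 < ‖z‖ → χ (ι z) = 0 := fun z hz => hχ0 _ (by rwa [ι.norm_map])
  have hI : Integrable fun z => χ (ι z) ^ 2 :=
    integrable_of_eq_zero_of_norm (hχι.pow 2) (R := 1 / 2) fun z hz => by rw [hχι0 z hz]; simp
  have hBPc : Continuous fun z => B (P z) (P z) := by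
    simp only [B]; fun_prop
  have hJ : Integrable fun z => B (P z) (P z) :=
    integrable_of_eq_zero_of_norm hBPc (R := 1 / 2) fun z hz => by simp [B, hP0 z hz]
  have hIpos : 0 < I := by
    refine (hχι.pow 2).integral_pos_of_hasCompactSupport_nonneg_nonzero (x := 0) ?_ ?_ ?_
    · exact HasCompactSupport.intro (isCompact_closedBall 0 (1 / 2)) fun z hz => by
        rw [hχι0 z (by simpa using hz)]; simp
    · intro z; positivity
    · have : χ (ι 0) = 1 := χ.one_of_mem_closedBall (by simp [χ])
      rw [this]; simp
  have hBe : B e e < 0 := he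
  -- The frequency is taken so large that the energy of the cutoff, of size `k⁻² |J|`, cannot
  -- outweigh the negative energy `B e e * I` of the oscillation.
  let k := 1 + |J| / (-(B e e) * I)
  have hden : 0 < -(B e e) * I := by nlinarith
  have hk1 : 1 ≤ k := le_add_of_nonneg_right (by positivity)
  have hk0 : k ≠ 0 := by positivity
  have hneg : B e e * I + (k⁻¹) ^ 2 * J < 0 := by
    have h1 : |J| < k * (-(B e e) * I) := by
      rw [← div_lt_iff₀ hden]; simp [k]
    have h2 : (k⁻¹) ^ 2 * J ≤ k⁻¹ * |J| := by
      have : (k⁻¹) ^ 2 ≤ k⁻¹ := by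
        rw [pow_two]; exact mul_le_of_le_one_left (by positivity) (inv_le_one_of_one_le₀ hk1)
      exact (mul_le_mul_of_nonneg_left (le_abs_self J) (by positivity)).trans
        (mul_le_mul_of_nonneg_right this (abs_nonneg J))
    have h3 : k⁻¹ * |J| < -(B e e) * I := by
      rw [inv_mul_lt_iff₀ (by positivity)]; exact h1
    linarith
  -- Two phases a quarter period apart are used: in the sum of their energies the cross terms cancel
  -- and `sin² + cos² = 1` removes the oscillation. One of the two energies must then be negative,
  -- and no limit `k → ∞` is needed.
  let u : ℝ → E → ℝ := fun a x => k⁻¹ * (χ x * Real.cos (k * ⟪ι e, x⟫ + a))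
  have hu : ∀ a, ContDiff ℝ ∞ (u a) := fun a => by
    refine contDiff_const.mul (hχc.mul (Real.contDiff_cos.comp ?_))
    exact (contDiff_const.mul (contDiff_const.inner ℝ contDiff_id)).add contDiff_const
  have hu0 : ∀ a x, 1 / 2 < ‖x‖ → u a x = 0 := fun a x hx => by
    simp only [u, hχ0 x hx]; ring
  have hgrad : ∀ a x, ∇ (u a) x = (k⁻¹ * Real.cos (k * ⟪ι e, x⟫ + a)) • ∇ χ x -
      (χ x * Real.sin (k * ⟪ι e, x⟫ + a)) • ι e := fun a x => by
    refine HasGradientAt.gradient (hasGradientAt_iff_hasFDerivAt.2 ?_)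
    have h1 : HasFDerivAt χ (innerSL ℝ (∇ χ x)) x :=
      ((hχc.differentiable (by simp)) x).hasGradientAt.hasFDerivAt
    have h2 : HasFDerivAt (fun x => k * ⟪ι e, x⟫ + a) (k • innerSL ℝ (ι e)) x :=
      ((innerSL ℝ (ι e)).hasFDerivAt.const_mul k).add_const a
    have h3 := (h1.mul h2.cos).const_mul k⁻¹
    refine h3.congr_fderiv ?_
    ext v
    simp
    field_simp
    ring
  have hp : ∀ a z, frameProj ι (∇ (u a) (ι z)) = (k⁻¹ * Real.cos (k * ⟪e, z⟫ + a)) • P z -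
      (χ (ι z) * Real.sin (k * ⟪e, z⟫ + a)) • e := fun a z => by
    rw [hgrad, map_sub, map_smul, map_smul, ι.inner_map_map]
    have : frameProj ι (ι e) = e := by simpa using H.frameProj_add e 0
    rw [this]
  let q : ℝ → V → ℝ := fun a z =>
    ⟪ι (frameProj ι (∇ (u a) (ι z))), A (ι (frameProj ι (∇ (u a) (ι z))))⟫
  have hqi : ∀ a, Integrable (q a) := fun a => by
    have hc : Continuous fun z => frameProj ι (∇ (u a) (ι z)) := (frameProj ι).continuous.comp
      ((continuous_gradient ((hu a).of_le (by simp))).comp ι.continuous)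
    refine integrable_of_eq_zero_of_norm (R := 1 / 2) (by simp only [q]; fun_prop) fun z hz => ?_
    simp only [q]
    rw [eq_zero_of_gradient (hu0 a) (by rwa [ι.norm_map])]; simp
  have hsum : ∫ z, q 0 z + q (Real.pi / 2) z = B e e * I + (k⁻¹) ^ 2 * J := by
    have : ∀ z, q 0 z + q (Real.pi / 2) z =
        B e e * χ (ι z) ^ 2 + (k⁻¹) ^ 2 * B (P z) (P z) := fun z => by
      have hq : ∀ a, q a z = B (frameProj ι (∇ (u a) (ι z))) (frameProj ι (∇ (u a) (ι z))) :=
        fun a => rfl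
      simp only [hq, hp, hB, hB', add_zero, Real.cos_add_pi_div_two, Real.sin_add_pi_div_two]
      linear_combination (B e e * χ (ι z) ^ 2 + (k⁻¹) ^ 2 * B (P z) (P z)) *
        Real.sin_sq_add_cos_sq (k * ⟪e, z⟫)
    simp_rw [this]
    rw [integral_add (hI.const_mul _) (hJ.const_mul _), integral_const_mul, integral_const_mul]
  rw [integral_add (hqi _) (hqi _)] at hsum
  by_cases h0 : ∫ z, q 0 z < 0
  · exact ⟨u 0, hu 0, hu0 0, h0⟩
  · refine ⟨u (Real.pi / 2), hu _, hu0 _, ?_⟩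
    change ∫ z, q (Real.pi / 2) z < 0
    linarith

/-- Integration by parts against the constant `1`; it kills the term linear in the slope. -/
theorem integral_inner_gradient_eq_zero {f : V → ℝ} (hf : ContDiff ℝ 1 f) {R : ℝ}
    (h0 : ∀ z, R < ‖z‖ → f z = 0) (a : V) : ∫ z, ⟪a, ∇ f z⟫ = 0 := by
  have hg : Continuous fun z => fderiv ℝ f z a :=
    (hf.continuous_fderiv one_ne_zero).clm_apply continuous_const
  have hg0 : ∀ z, R < ‖z‖ → fderiv ℝ f z a = 0 := fun z hz => by
    rw [← inner_gradient_left, eq_zero_of_gradient h0 hz, inner_zero_left]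
  have h := integral_mul_fderiv_eq_neg_fderiv_mul_of_integrable (μ := (volume : Measure V))
    (f := fun _ => (1 : ℝ)) (g := f) (v := a) (by simp)
    (by simpa using integrable_of_eq_zero_of_norm hg hg0)
    (by simpa using integrable_of_eq_zero_of_norm hf.continuous h0)
    (by simp) fun x _ => hf.differentiable one_ne_zero x
  simp only [one_mul, fderiv_fun_const, Pi.zero_apply, zero_apply, zero_mul, integral_zero,
    neg_zero] at h
  rw [← h]
  exact integral_congr_ae (.of_forall fun z => by
    change ⟪a, ∇ f z⟫ = fderiv ℝ f z a
    rw [← inner_gradient_left, real_inner_comm])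

/-- The integrand `⟪N, A N⟫ / ‖N‖` of the transport functional on graphs, with `N = ν - ι p`. -/
noncomputable def graphIntegrand (ι : V →ₗᵢ[ℝ] E) (ν : E) (A : E →L[ℝ] E) (p : V) : ℝ :=
  ⟪ν - ι p, A (ν - ι p)⟫ / √(1 + ‖p‖ ^ 2)

omit [FiniteDimensional ℝ V] [FiniteDimensional ℝ E] [MeasurableSpace V] [BorelSpace V] in
-- Since `⟪ν, A ν⟫ = 0`, the numerator is exactly quadratic in `s` without constant term, hence
-- `O(s)`. The factor `1 / √(1 + s² ‖p‖²)` differs from `1` by at most `s² ‖p‖²`, so the error is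
-- cubic and does not spoil the quadratic term.
theorem graphIntegrand_le {ι : V →ₗᵢ[ℝ] E} {ν : E} {A : E →L[ℝ] E} (hν : ⟪ν, A ν⟫ = 0) (p : V)
    {s : ℝ} (hs0 : 0 ≤ s) (hs1 : s ≤ 1) :
    graphIntegrand ι ν A (s • p) ≤
      s ^ 2 * ⟪ι p, A (ι p)⟫ - s * (⟪ν, A (ι p)⟫ + ⟪ι p, A ν⟫) +
      s ^ 3 * ((|⟪ν, A (ι p)⟫ + ⟪ι p, A ν⟫| + |⟪ι p, A (ι p)⟫|) * ‖p‖ ^ 2) := by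
  set ℓ := ⟪ν, A (ι p)⟫ + ⟪ι p, A ν⟫
  set q := ⟪ι p, A (ι p)⟫
  have hnum : ⟪ν - ι (s • p), A (ν - ι (s • p))⟫ = s ^ 2 * q - s * ℓ := by
    simp only [map_sub, map_smul, inner_sub_left, inner_sub_right, inner_smul_left,
      inner_smul_right, hν, conj_trivial, ℓ, q]
    ring
  set t := ‖s • p‖ ^ 2
  have ht : t = s ^ 2 * ‖p‖ ^ 2 := by
    simp only [t]; rw [norm_smul, Real.norm_eq_abs, mul_pow, sq_abs]
  have ht0 : 0 ≤ t := by positivity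
  have hpos : 0 < √(1 + t) := Real.sqrt_pos.2 (by positivity)
  have h1 : (√(1 + t))⁻¹ ≤ 1 := inv_le_one_of_one_le₀ (Real.one_le_sqrt.2 (by linarith))
  have h2 : 1 - t ≤ (√(1 + t))⁻¹ := by
    have h3 : √(1 + t) ≤ 1 + t := Real.sqrt_le_iff.2 ⟨by linarith, by nlinarith⟩
    have h4 : (1 + t)⁻¹ ≤ (√(1 + t))⁻¹ := inv_anti₀ hpos h3
    refine le_trans ?_ h4
    rw [← one_div, le_div_iff₀ (by positivity)]; nlinarith
  rw [graphIntegrand, hnum, div_eq_mul_inv]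
  set X := s ^ 2 * q - s * ℓ
  have hX : |X| ≤ s * (|ℓ| + |q|) := by
    have h5 : |X| ≤ |s ^ 2 * q| + |s * ℓ| := abs_sub _ _
    rw [abs_mul, abs_mul, abs_of_nonneg hs0, abs_of_nonneg (by positivity : 0 ≤ s ^ 2)] at h5
    have h6 : s ^ 2 * |q| ≤ s * |q| :=
      mul_le_mul_of_nonneg_right (by nlinarith) (abs_nonneg q)
    linarith
  have h7 : X * (√(1 + t))⁻¹ - X ≤ |X| * t := by
    have h8 : X * ((√(1 + t))⁻¹ - 1) ≤ |X| * |(√(1 + t))⁻¹ - 1| :=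
      (le_abs_self _).trans (abs_mul _ _).le
    have h9 : |(√(1 + t))⁻¹ - 1| ≤ t := by rw [abs_le]; constructor <;> linarith
    have := mul_le_mul_of_nonneg_left h9 (abs_nonneg X)
    linarith
  have h10 : |X| * t ≤ s * (|ℓ| + |q|) * (s ^ 2 * ‖p‖ ^ 2) := by
    rw [← ht]; exact mul_le_mul_of_nonneg_right hX ht0
  linarith

/-- Small multiples of the test function decrease the limiting functional. -/
theorem exists_integral_graphIntegrand_neg {ι : V →ₗᵢ[ℝ] E} {ν : E} {A : E →L[ℝ] E}
    (hν : ⟪ν, A ν⟫ = 0) {f : V → ℝ} (hf : ContDiff ℝ 1 f) {R : ℝ} (h0 : ∀ z, R < ‖z‖ → f z = 0)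
    (hQ : ∫ z, ⟪ι (∇ f z), A (ι (∇ f z))⟫ < 0) {s₀ : ℝ} (hs₀ : 0 < s₀) :
    ∃ s, 0 < s ∧ s ≤ s₀ ∧ ∫ z, graphIntegrand ι ν A (s • ∇ f z) < 0 := by
  have hc : Continuous (∇ f) := continuous_gradient hf
  have hg0 : ∀ z, R < ‖z‖ → ∇ f z = 0 := fun z hz => eq_zero_of_gradient h0 hz
  have hqi : Integrable fun z => ⟪ι (∇ f z), A (ι (∇ f z))⟫ :=
    integrable_of_eq_zero_of_norm (R := R) (by fun_prop) fun z hz => by simp [hg0 z hz]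
  have hℓi : Integrable fun z => ⟪ν, A (ι (∇ f z))⟫ + ⟪ι (∇ f z), A ν⟫ :=
    integrable_of_eq_zero_of_norm (R := R) (by fun_prop) fun z hz => by simp [hg0 z hz]
  have hri : Integrable fun z => (|⟪ν, A (ι (∇ f z))⟫ + ⟪ι (∇ f z), A ν⟫| +
      |⟪ι (∇ f z), A (ι (∇ f z))⟫|) * ‖∇ f z‖ ^ 2 :=
    integrable_of_eq_zero_of_norm (R := R) (by fun_prop) fun z hz => by simp [hg0 z hz]
  have hℓ : ∫ z, (⟪ν, A (ι (∇ f z))⟫ + ⟪ι (∇ f z), A ν⟫) = 0 := by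
    let a : V := frameProj ι (ContinuousLinearMap.adjoint A ν) + frameProj ι (A ν)
    rw [← integral_inner_gradient_eq_zero hf h0 a]
    congr 1; ext z
    simp only [a, inner_add_left, frameProj, ContinuousLinearMap.adjoint_inner_left]
    rw [real_inner_comm (A ν)]; rfl
  set Q := ∫ z, ⟪ι (∇ f z), A (ι (∇ f z))⟫
  set C := ∫ z, (|⟪ν, A (ι (∇ f z))⟫ + ⟪ι (∇ f z), A ν⟫| +
      |⟪ι (∇ f z), A (ι (∇ f z))⟫|) * ‖∇ f z‖ ^ 2
  have hC : 0 ≤ C := integral_nonneg fun z => by positivity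
  -- The second bound gives `s * C ≤ -Q / 2`, so the cubic error takes back at most half of the
  -- quadratic gain.
  let s := min (min s₀ 1) (-Q / (2 * (C + 1)))
  have hQC : 0 < -Q / (2 * (C + 1)) := div_pos (by linarith) (by positivity)
  have hs : 0 < s := lt_min (lt_min hs₀ one_pos) hQC
  have hs1 : s ≤ 1 := (min_le_left _ _).trans (min_le_right _ _)
  refine ⟨s, hs, (min_le_left _ _).trans (min_le_left _ _), ?_⟩
  have hΦc : Continuous fun z => graphIntegrand ι ν A (s • ∇ f z) := by
    unfold graphIntegrand
    exact Continuous.div (by fun_prop) (by fun_prop) fun z => (Real.sqrt_pos.2 (by positivity)).ne'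
  have hΦi : Integrable fun z => graphIntegrand ι ν A (s • ∇ f z) :=
    integrable_of_eq_zero_of_norm (R := R) hΦc fun z hz => by
      simp [hg0 z hz, graphIntegrand, hν]
  have hle := integral_mono hΦi (((hqi.const_mul (s ^ 2)).sub (hℓi.const_mul s)).add
    (hri.const_mul (s ^ 3))) fun z => graphIntegrand_le (ι := ι) hν (∇ f z) hs.le hs1
  refine hle.trans_lt ?_
  rw [integral_add' ((hqi.const_mul (s ^ 2)).sub (hℓi.const_mul s)) (hri.const_mul (s ^ 3)),
    integral_sub' (hqi.const_mul (s ^ 2)) (hℓi.const_mul s), integral_const_mul, integral_const_mul,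
    integral_const_mul, hℓ]
  have h3 : s * (2 * (C + 1)) ≤ -Q := by
    rw [← le_div_iff₀ (by positivity)]; exact min_le_right _ _
  have h4 : s ^ 2 * (Q + s * C) < 0 := mul_neg_of_pos_of_neg (by positivity) (by nlinarith)
  change s ^ 2 * Q - s * 0 + s ^ 3 * C < 0
  linarith

end TestFunction

end DiffusiveTransport

/-! ### Blow-up of a wrinkled graph. -/

namespace DiffusiveTransport

open Module Filter
open scoped Gradient

section Rescaling

variable {V E : Type*} [NormedAddCommGroup V] [InnerProductSpace ℝ V]
  [NormedAddCommGroup E] [InnerProductSpace ℝ E]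

/-- The graph function of the graph of `w`, displaced in the direction `ν` by the rescaled test
function `s r u((x - x₀) / r)`. -/
noncomputable def wrinkle (ι : V →ₗᵢ[ℝ] E) (ν : E) (w : V → ℝ) (u : E → ℝ) (s r : ℝ) (y : V) : ℝ :=
  w y + s * r * u (r⁻¹ • (ι y + w y • ν))

variable {ι : V →ₗᵢ[ℝ] E} {ν : E} {w : V → ℝ} {u : E → ℝ} {s r : ℝ}

theorem contDiff_wrinkle (hw : ContDiff ℝ 1 w) (hu : ContDiff ℝ 1 u) :
    ContDiff ℝ 1 (wrinkle ι ν w u s r) := by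
  have hι : ContDiff ℝ 1 ι := ι.toContinuousLinearMap.contDiff
  exact hw.add (contDiff_const.mul (hu.comp
    (contDiff_const.smul (hι.add (hw.smul contDiff_const)))))

/-- Displacing a graph along `ν` yields a graph over the same parameter, so the perturbed surface
needs no reparametrization. -/
theorem graphMap_wrinkle (x₀ : E) (y : V) :
    graphMap ι ν x₀ (wrinkle ι ν w u s r) y =
      graphMap ι ν x₀ w y + (s * r * u (r⁻¹ • (graphMap ι ν x₀ w y - x₀))) • ν := by
  simp only [graphMap, wrinkle, add_sub_cancel_left]
  module

theorem exists_bound_gradient {F : Type*} [NormedAddCommGroup F] [InnerProductSpace ℝ F]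
    [CompleteSpace F] {f : F → ℝ} (hf : ContDiff ℝ 1 f) (hc : HasCompactSupport f) :
    ∃ C, ∀ x, ‖∇ f x‖ ≤ C := by
  obtain ⟨C, hC⟩ := (hc.fderiv ℝ).exists_bound_of_continuous (hf.continuous_fderiv one_ne_zero)
  exact ⟨C, fun x => by rw [gradient, LinearIsometryEquiv.norm_map]; exact hC x⟩

theorem tendsto_smul_nhdsGT (z : V) : Tendsto (fun r : ℝ => r • z) (𝓝[>] 0) (𝓝 0) := by
  have hid : Tendsto (fun r : ℝ => r) (𝓝[>] 0) (𝓝 0) := tendsto_id.mono_left nhdsWithin_le_nhds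
  simpa using hid.smul_const z

/-- `w` vanishes to first order at `0`, so `w (r • z) / r → 0` and the rescaled graph flattens to
its tangent plane. -/
theorem tendsto_rescaled_graph [FiniteDimensional ℝ V] (hw : ContDiff ℝ 1 w) (hw0 : w 0 = 0)
    (hw1 : ∇ w 0 = 0) (z : V) :
    Tendsto (fun r : ℝ => r⁻¹ • (ι (r • z) + w (r • z) • ν)) (𝓝[>] 0) (𝓝 (ι z)) := by
  have h1 : HasFDerivAt w (innerSL ℝ (∇ w 0)) 0 :=
    (hw.differentiable one_ne_zero 0).hasGradientAt.hasFDerivAt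
  have h2 : HasDerivAt (fun t : ℝ => w (t • z)) 0 0 := by
    have h3 : HasDerivAt (fun t : ℝ => t • z) z 0 := by
      simpa using (hasDerivAt_id (0 : ℝ)).smul_const z
    refine (h1.comp_hasDerivAt_of_eq 0 h3 (by simp)).congr_deriv ?_
    simp [hw1]
  have h4 := h2.tendsto_slope_zero_right
  simp only [zero_add, zero_smul, hw0, sub_zero] at h4
  have h5 : Tendsto (fun r : ℝ => ι z + (r⁻¹ • w (r • z)) • ν) (𝓝[>] 0) (𝓝 (ι z)) := by
    simpa using (h4.smul_const ν).const_add (ι z)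
  refine h5.congr' ?_
  filter_upwards [self_mem_nhdsWithin] with r (hr : 0 < r)
  simp only [map_smul, smul_add, smul_smul, inv_mul_cancel₀ hr.ne', one_smul, smul_eq_mul]

theorem tendsto_graphMap_wrinkle [FiniteDimensional ℝ V] (x₀ : E) (hw : ContDiff ℝ 1 w)
    (hw0 : w 0 = 0) (hw1 : ∇ w 0 = 0) (hu : Continuous u) (z : V) :
    Tendsto (fun r => graphMap ι ν x₀ (wrinkle ι ν w u s r) (r • z)) (𝓝[>] 0) (𝓝 x₀) := by
  have hid : Tendsto (fun r : ℝ => r) (𝓝[>] 0) (𝓝 0) := tendsto_id.mono_left nhdsWithin_le_nhds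
  have hX := tendsto_rescaled_graph (ι := ι) (ν := ν) hw hw0 hw1 z
  have h1 := (((hid.smul hX).add (((hid.const_mul s).mul
    ((hu.tendsto _).comp hX)).smul_const ν)).const_add x₀)
  simp only [zero_smul, mul_zero, zero_mul, add_zero] at h1
  refine h1.congr' ?_
  filter_upwards [self_mem_nhdsWithin] with r (hr : 0 < r)
  simp only [graphMap, wrinkle, Function.comp_apply, smul_smul, mul_inv_cancel₀ hr.ne', one_smul,
    add_smul]
  abel

variable [FiniteDimensional ℝ V] [FiniteDimensional ℝ E]

/-- The amplitude `r` cancels the `r⁻¹` of the rescaling, so the slope stays of order `s` as `r →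
0`. -/
theorem gradient_wrinkle (hw : ContDiff ℝ 1 w) (hu : ContDiff ℝ 1 u) (hr : r ≠ 0) (y : V) :
    ∇ (wrinkle ι ν w u s r) y = ∇ w y +
      s • (frameProj ι (∇ u (r⁻¹ • (ι y + w y • ν))) +
        ⟪∇ u (r⁻¹ • (ι y + w y • ν)), ν⟫ • ∇ w y) := by
  refine HasGradientAt.gradient (hasGradientAt_iff_hasFDerivAt.2 ?_)
  have h1 : HasFDerivAt w (innerSL ℝ (∇ w y)) y :=
    (hw.differentiable one_ne_zero y).hasGradientAt.hasFDerivAt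
  have h2 : HasFDerivAt (fun y => r⁻¹ • (ι y + w y • ν))
      (r⁻¹ • (ι.toContinuousLinearMap + (innerSL ℝ (∇ w y)).smulRight ν)) y :=
    (ι.toContinuousLinearMap.hasFDerivAt.add (h1.smul_const ν)).const_smul r⁻¹
  have h3 : HasFDerivAt u (innerSL ℝ (∇ u (r⁻¹ • (ι y + w y • ν)))) (r⁻¹ • (ι y + w y • ν)) :=
    (hu.differentiable one_ne_zero _).hasGradientAt.hasFDerivAt
  have h4 := h1.add ((h3.comp y h2).const_mul (s * r))
  refine h4.congr_fderiv ?_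
  ext v
  have h5 : ∀ a, ⟪frameProj ι a, v⟫ = ⟪a, ι v⟫ := fun a =>
    ContinuousLinearMap.adjoint_inner_left _ _ _
  simp [h5]
  field_simp

theorem tendsto_gradient_wrinkle (hw : ContDiff ℝ 1 w) (hw0 : w 0 = 0) (hw1 : ∇ w 0 = 0)
    (hu : ContDiff ℝ 1 u) (z : V) :
    Tendsto (fun r => ∇ (wrinkle ι ν w u s r) (r • z)) (𝓝[>] 0)
      (𝓝 (s • frameProj ι (∇ u (ι z)))) := by
  have hX := tendsto_rescaled_graph (ι := ι) (ν := ν) hw hw0 hw1 z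
  have hgw : Tendsto (fun r : ℝ => ∇ w (r • z)) (𝓝[>] 0) (𝓝 0) := by
    have := ((continuous_gradient hw).tendsto 0).comp (tendsto_smul_nhdsGT z)
    rwa [hw1] at this
  have hgu := ((continuous_gradient hu).tendsto _).comp hX
  have h1 := hgw.add (((((frameProj ι).continuous.tendsto _).comp hgu).add
    ((Tendsto.inner (𝕜 := ℝ) hgu (tendsto_const_nhds (x := ν))).smul hgw)).const_smul s)
  rw [smul_zero, add_zero, zero_add] at h1
  refine h1.congr' ?_
  filter_upwards [self_mem_nhdsWithin] with r (hr : 0 < r)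
  rw [gradient_wrinkle hw hu hr.ne']
  rfl

variable (H : IsHyperplaneFrame ι ν)
include H

omit [FiniteDimensional ℝ E] in
theorem IsHyperplaneFrame.hasCompactSupport_wrinkle (hc : HasCompactSupport w)
    (hu : ∀ x, 1 / 2 < ‖x‖ → u x = 0) (hr : 0 < r) :
    HasCompactSupport (wrinkle ι ν w u s r) := by
  refine HasCompactSupport.intro (hc.isCompact.union (isCompact_closedBall 0 r)) fun y hy => ?_
  rw [mem_union, not_or] at hy
  have h1 : w y = 0 := image_eq_zero_of_notMem_tsupport hy.1
  have h2 : r < ‖y‖ := by simpa using hy.2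
  rw [wrinkle, hu, h1]
  · ring
  · rw [norm_smul, norm_inv, Real.norm_eq_abs, abs_of_pos hr]
    calc (1 / 2 : ℝ) < 1 := by norm_num
      _ < r⁻¹ * ‖y‖ := by rwa [inv_mul_eq_div, one_lt_div hr]
      _ ≤ _ := by gcongr; exact H.norm_le_norm_add _ _

omit [FiniteDimensional ℝ V] [FiniteDimensional ℝ E] in
theorem IsHyperplaneFrame.abs_graphIntegrand_le (A : E →L[ℝ] E) (p : V) :
    |graphIntegrand ι ν A p| ≤ ‖A‖ * (1 + ‖p‖) := by
  have hpos : 0 < √(1 + ‖p‖ ^ 2) := Real.sqrt_pos.2 (by positivity)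
  have h1 : |⟪ν - ι p, A (ν - ι p)⟫| ≤ ‖A‖ * (1 + ‖p‖ ^ 2) := by
    rw [← H.norm_sub_sq]
    refine (abs_real_inner_le_norm _ _).trans ?_
    have := A.le_opNorm (ν - ι p)
    nlinarith [norm_nonneg (ν - ι p)]
  have h2 : √(1 + ‖p‖ ^ 2) ≤ 1 + ‖p‖ :=
    Real.sqrt_le_iff.2 ⟨by positivity, by nlinarith [norm_nonneg p]⟩
  rw [graphIntegrand, abs_div, abs_of_pos hpos, div_le_iff₀ hpos]
  refine h1.trans ?_
  rw [mul_assoc]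
  gcongr
  calc 1 + ‖p‖ ^ 2 = √(1 + ‖p‖ ^ 2) * √(1 + ‖p‖ ^ 2) :=
        (Real.mul_self_sqrt (by positivity)).symm
    _ ≤ _ := by gcongr

omit H [FiniteDimensional ℝ V] [FiniteDimensional ℝ E] in
theorem continuous_graphIntegrand :
    Continuous fun q : (E →L[ℝ] E) × V => graphIntegrand ι ν q.1 q.2 := by
  unfold graphIntegrand
  exact Continuous.div (by fun_prop) (by fun_prop) fun z => (Real.sqrt_pos.2 (by positivity)).ne'

omit H [FiniteDimensional ℝ V] [FiniteDimensional ℝ E] in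
theorem tendsto_graphIntegrand {α : Type*} {l : Filter α} {a : α → E →L[ℝ] E} {p : α → V}
    {A : E →L[ℝ] E} {q : V} (ha : Tendsto a l (𝓝 A)) (hp : Tendsto p l (𝓝 q)) :
    Tendsto (fun r => graphIntegrand ι ν (a r) (p r)) l (𝓝 (graphIntegrand ι ν A q)) := by
  have h := (continuous_graphIntegrand (ι := ι) (ν := ν)).tendsto (A, q)
  exact h.comp (ha.prodMk_nhds hp)

omit H [FiniteDimensional ℝ V] [FiniteDimensional ℝ E] in
theorem continuousOn_graphIntegrand {X : Type*} [TopologicalSpace X] {S : Set X}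
    {a : X → E →L[ℝ] E} {p : X → V} (ha : ContinuousOn a S) (hp : ContinuousOn p S) :
    ContinuousOn (fun x => graphIntegrand ι ν (a x) (p x)) S := by
  have h := (continuous_graphIntegrand (ι := ι) (ν := ν)).comp_continuousOn (ha.prodMk hp)
  exact h

omit H in
theorem tendsto_indicator_graphIntegrand {W : Set E} (hW : IsOpen W) {x₀ : E}
    (hx₀ : x₀ ∈ W) {A : E → E →L[ℝ] E} (hA : ContinuousOn A W) (hν : ⟪ν, A x₀ ν⟫ = 0)
    (hw : ContDiff ℝ 1 w) (hw0 : w 0 = 0) (hw1 : ∇ w 0 = 0)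
    (hu : ContDiff ℝ 1 u) (hu0 : ∀ x, 1 / 2 < ‖x‖ → u x = 0) (z : V) :
    Tendsto (fun r => {y | ‖ι y + w y • ν‖ ≤ r}.indicator (fun y =>
      graphIntegrand ι ν (A (graphMap ι ν x₀ (wrinkle ι ν w u s r) y))
        (∇ (wrinkle ι ν w u s r) y)) (r • z)) (𝓝[>] 0)
      (𝓝 (graphIntegrand ι ν (A x₀) (s • frameProj ι (∇ u (ι z))))) := by
  have hX := tendsto_rescaled_graph (ι := ι) (ν := ν) hw hw0 hw1 z
  have hp := tendsto_gradient_wrinkle (ι := ι) (ν := ν) (s := s) hw hw0 hw1 hu z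
  have hφ := tendsto_graphMap_wrinkle (ι := ι) (ν := ν) (s := s) x₀ hw hw0 hw1 hu.continuous z
  have hAt := ((hA.continuousAt (hW.mem_nhds hx₀)).tendsto).comp hφ
  have hΨ := tendsto_graphIntegrand (ι := ι) (ν := ν) hAt hp
  -- For `‖z‖ < 1` the indicator is eventually `1`. Otherwise `ι z` lies outside the support of `u`,
  -- the limit is `0`, and the value of the indicator does not matter; the gap between `1 / 2` and
  -- `1` avoids any discussion of the sphere.
  by_cases hz : ‖z‖ < 1
  · refine hΨ.congr' ?_
    have hXn : ∀ᶠ r in 𝓝[>] (0 : ℝ), ‖r⁻¹ • (ι (r • z) + w (r • z) • ν)‖ < 1 :=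
      hX.norm.eventually_lt_const (by rwa [ι.norm_map])
    filter_upwards [self_mem_nhdsWithin, hXn] with r (hr : 0 < r) hXr
    rw [indicator_of_mem, Function.comp_apply]
    change ‖ι (r • z) + w (r • z) • ν‖ ≤ r
    rw [← smul_inv_smul₀ hr.ne' (ι (r • z) + w (r • z) • ν), norm_smul,
      Real.norm_eq_abs, abs_of_pos hr]
    exact mul_le_of_le_one_right hr.le hXr.le
  · have hgz : ∇ u (ι z) = 0 := eq_zero_of_gradient hu0 (by
      rw [ι.norm_map]; push Not at hz; linarith)
    rw [hgz, map_zero, smul_zero] at hΨ ⊢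
    have h0 : graphIntegrand ι ν (A x₀) (0 : V) = 0 := by simp [graphIntegrand, hν]
    rw [h0] at hΨ ⊢
    have hΨn := hΨ.norm
    rw [norm_zero] at hΨn
    exact squeeze_zero_norm (fun r => norm_indicator_le_norm_self _ _) hΨn

variable [MeasurableSpace V] [BorelSpace V]

set_option maxHeartbeats 400000 in
/-- At small scales the functional on the wrinkled graph is governed by its linearization. -/
theorem IsHyperplaneFrame.eventually_integral_wrinkle_neg {W : Set E} (hW : IsOpen W) {x₀ : E}
    (hx₀ : x₀ ∈ W) {A : E → E →L[ℝ] E} (hA : ContinuousOn A W) (hν : ⟪ν, A x₀ ν⟫ = 0)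
    (hw : ContDiff ℝ 1 w) (hwc : HasCompactSupport w) (hw0 : w 0 = 0) (hw1 : ∇ w 0 = 0)
    (hu : ContDiff ℝ 1 u) (hu0 : ∀ x, 1 / 2 < ‖x‖ → u x = 0)
    (hneg : ∫ z, graphIntegrand ι ν (A x₀) (s • frameProj ι (∇ u (ι z))) < 0) :
    ∀ᶠ r in 𝓝[>] (0 : ℝ), ∫ y in {y | ‖ι y + w y • ν‖ ≤ r},
      graphIntegrand ι ν (A (graphMap ι ν x₀ (wrinkle ι ν w u s r) y))
        (∇ (wrinkle ι ν w u s r) y) < 0 := by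
  let S : ℝ → Set V := fun r => {y | ‖ι y + w y • ν‖ ≤ r}
  let Ψ : ℝ → V → ℝ := fun r y =>
    graphIntegrand ι ν (A (graphMap ι ν x₀ (wrinkle ι ν w u s r) y)) (∇ (wrinkle ι ν w u s r) y)
  have hS : ∀ r, IsClosed (S r) := fun r =>
    isClosed_le ((ι.continuous.add (hw.continuous.smul continuous_const)).norm) continuous_const
  have huc : HasCompactSupport u := HasCompactSupport.intro (isCompact_closedBall 0 (1 / 2))
    fun x hx => hu0 x (by simpa using hx)
  obtain ⟨Cu, hCu⟩ := huc.exists_bound_of_continuous hu.continuous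
  obtain ⟨Gu, hGu⟩ := exists_bound_gradient hu huc
  obtain ⟨Gw, hGw⟩ := exists_bound_gradient hw hwc
  have hGu0 : 0 ≤ Gu := (norm_nonneg _).trans (hGu 0)
  obtain ⟨ρ, hρ, hρW⟩ := Metric.nhds_basis_closedBall.mem_iff.1 (hW.mem_nhds hx₀)
  obtain ⟨CA, hCA⟩ := (isCompact_closedBall x₀ ρ).exists_bound_of_continuousOn (hA.mono hρW)
  have hCA0 : 0 ≤ CA := (norm_nonneg _).trans (hCA x₀ (Metric.mem_closedBall_self hρ.le))
  have hgradb : ∀ r, r ≠ 0 → ∀ y, ‖∇ (wrinkle ι ν w u s r) y‖ ≤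
      Gw + |s| * (‖frameProj ι‖ * Gu + Gu * Gw) := by
    intro r hr y
    rw [gradient_wrinkle hw hu hr]
    refine (norm_add_le _ _).trans (add_le_add (hGw y) ?_)
    rw [norm_smul, Real.norm_eq_abs]
    gcongr
    refine (norm_add_le _ _).trans (add_le_add ((frameProj ι).le_of_opNorm_le_of_le le_rfl
      (hGu _)) ?_)
    rw [norm_smul]
    refine mul_le_mul ?_ (hGw y) (norm_nonneg _) hGu0
    refine (norm_inner_le_norm _ _).trans ?_
    rw [H.norm_eq_one, mul_one]; exact hGu _
  have hsmall : ∀ᶠ r in 𝓝[>] (0 : ℝ), 0 < r ∧ r * (1 + |s| * Cu) ≤ ρ := by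
    refine (eventually_mem_nhdsWithin).and (Eventually.filter_mono nhdsWithin_le_nhds ?_)
    exact ((by fun_prop : Continuous fun r : ℝ => r * (1 + |s| * Cu)).continuousAt.eventually_lt
      continuousAt_const (by simpa using hρ)).mono fun _ h => h.le
  have hmem : ∀ r, 0 < r → r * (1 + |s| * Cu) ≤ ρ → ∀ y ∈ S r,
      graphMap ι ν x₀ (wrinkle ι ν w u s r) y ∈ Metric.closedBall x₀ ρ := by
    intro r hr hrρ y hy
    rw [mem_closedBall_iff_norm]
    refine le_trans ?_ hrρ
    have : graphMap ι ν x₀ (wrinkle ι ν w u s r) y - x₀ =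
        (ι y + w y • ν) + (s * r * u (r⁻¹ • (ι y + w y • ν))) • ν := by
      simp only [graphMap, wrinkle]; module
    rw [this]
    refine (norm_add_le _ _).trans ?_
    rw [norm_smul, H.norm_eq_one, mul_one, Real.norm_eq_abs, abs_mul, abs_mul, abs_of_pos hr]
    have h1 : ‖ι y + w y • ν‖ ≤ r := hy
    have h2 : |u (r⁻¹ • (ι y + w y • ν))| ≤ Cu := hCu _
    have h3 := mul_le_mul_of_nonneg_left h2 (by positivity : 0 ≤ |s| * r)
    linarith
  -- After the substitution `y = r • z` the domains lie in the unit ball and the integrands are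
  -- uniformly bounded, so dominated convergence applies.
  have hlim : Tendsto (fun r => ∫ z, (S r).indicator (Ψ r) (r • z)) (𝓝[>] 0)
      (𝓝 (∫ z, graphIntegrand ι ν (A x₀) (s • frameProj ι (∇ u (ι z))))) := by
    refine tendsto_integral_filter_of_dominated_convergence
      ((Metric.closedBall (0 : V) 1).indicator fun _ =>
        CA * (1 + (Gw + |s| * (‖frameProj ι‖ * Gu + Gu * Gw)))) ?_ ?_ ?_ ?_
    · filter_upwards [hsmall] with r hr
      have hZ : IsClosed ((fun z : V => r • z) ⁻¹' S r) := (hS r).preimage (by fun_prop)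
      have heq : (fun z => (S r).indicator (Ψ r) (r • z)) =
          ((fun z : V => r • z) ⁻¹' S r).indicator fun z => Ψ r (r • z) := by
        ext z; simp only [indicator]; rfl
      rw [heq, aestronglyMeasurable_indicator_iff hZ.measurableSet]
      refine ContinuousOn.aestronglyMeasurable ?_ hZ.measurableSet
      have hwr := contDiff_wrinkle (ι := ι) (ν := ν) (s := s) (r := r) hw hu
      refine continuousOn_graphIntegrand ?_ ?_
      · refine hA.comp ((continuous_graphMap hwr.continuous).comp
          (continuous_const_smul r)).continuousOn fun z hz => hρW (hmem r hr.1 hr.2 _ hz)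
      · exact ((continuous_gradient hwr).comp (continuous_const_smul r)).continuousOn
    · filter_upwards [hsmall] with r hr
      refine .of_forall fun z => ?_
      by_cases hz : r • z ∈ S r
      · have hz1 : z ∈ Metric.closedBall (0 : V) 1 := by
          have h1 : ‖r • z‖ ≤ r := (H.norm_le_norm_add _ _).trans hz
          rw [norm_smul, Real.norm_eq_abs, abs_of_pos hr.1] at h1
          rw [mem_closedBall_zero_iff]
          exact le_of_mul_le_mul_left (by linarith) hr.1
        rw [indicator_of_mem hz, indicator_of_mem hz1]
        refine (H.abs_graphIntegrand_le _ _).trans ?_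
        gcongr
        · exact hCA _ (hmem r hr.1 hr.2 _ hz)
        · exact hgradb r hr.1.ne' _
      · rw [indicator_of_notMem hz, norm_zero]
        have : 0 ≤ Gw := (norm_nonneg _).trans (hGw 0)
        exact indicator_nonneg (fun _ _ => by positivity) _
    · rw [integrable_indicator_iff Metric.isClosed_closedBall.measurableSet]
      exact integrableOn_const measure_closedBall_lt_top.ne
    · exact .of_forall fun z => tendsto_indicator_graphIntegrand hW hx₀ hA hν hw hw0 hw1 hu hu0 z
  filter_upwards [hlim.eventually_lt_const hneg, hsmall] with r hr1 hr2
  -- Undoing the substitution costs a nonnegative power of `r⁻¹`, so the sign of the integral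
  -- carries over.
  rw [Measure.integral_comp_smul_of_nonneg _ _ _ (hR := hr2.1.le), smul_eq_mul,
    integral_indicator (hS r).measurableSet] at hr1
  by_contra h
  exact hr1.not_ge (mul_nonneg (inv_nonneg.2 (pow_nonneg hr2.1.le _)) (not_lt.1 h))

end Rescaling

end DiffusiveTransport

/-! ### Surface integrals over graphs, and local displacements. -/

namespace DiffusiveTransport

open Module Filter
open scoped Gradient

section GraphDensity

variable {n : ℕ} {ι : Space (n - 1) →ₗᵢ[ℝ] Space n} {ν : Space n}

/-- Integrals over a piece of a graph. -/
theorem IsHyperplaneFrame.setIntegral_graphMap_image (H : IsHyperplaneFrame ι ν) (x₀ : Space n)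
    {w : Space (n - 1) → ℝ} (hw : ContDiff ℝ 1 w) (hc : HasCompactSupport w)
    {S : Set (Space (n - 1))} (hS : MeasurableSet S) (f : Space n → ℝ) :
    ∫ x in graphMap ι ν x₀ w '' S, f x ∂μHE[n - 1] =
      ∫ y in S, √(1 + ‖∇ w y‖ ^ 2) * f (graphMap ι ν x₀ w y) := by
  have hme := H.measurableEmbedding_graphMap x₀ hw.continuous
  have harea := H.comap_graphMap x₀ hw hc
  rw [finrank_euclideanSpace_fin] at harea
  have h1 : (μHE[n - 1] : Measure (Space n)).restrict (graphMap ι ν x₀ w '' S) =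
      ((volume.withDensity fun y => ENNReal.ofReal √(1 + ‖∇ w y‖ ^ 2)).restrict S).map
        (graphMap ι ν x₀ w) := by
    have h2 := hme.restrict_map ((μHE[n - 1] : Measure (Space n)).comap (graphMap ι ν x₀ w))
      (graphMap ι ν x₀ w '' S)
    rw [preimage_image_eq _ hme.injective, hme.map_comap,
      Measure.restrict_restrict_of_subset (image_subset_range _ _), harea] at h2
    exact h2
  have hcont : Continuous fun y => √(1 + ‖∇ w y‖ ^ 2) := by
    have := continuous_gradient hw
    fun_prop
  rw [h1, hme.integral_map, restrict_withDensity hS,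
    integral_withDensity_eq_integral_toReal_smul
      hcont.measurable.ennreal_ofReal (.of_forall fun _ => ENNReal.ofReal_lt_top)]
  simp only [ENNReal.toReal_ofReal (Real.sqrt_nonneg _), smul_eq_mul]

theorem isUnitNormal_unitNormal_of_exists {M : Set (Space n)} {p : Space n}
    (h : ∃ μ, IsUnitNormal M p μ) : IsUnitNormal M p (unitNormal M p) := by
  rw [unitNormal, dif_pos h]
  exact h.choose_spec

theorem isUnitNormal_congr {M N : Set (Space n)} {p : Space n}
    (h : ∀ᶠ x in 𝓝 p, x ∈ M ↔ x ∈ N) {μ : Space n} : IsUnitNormal M p μ ↔ IsUnitNormal N p μ := by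
  have h1 : M =ᶠ[𝓝 p] N := h.mono fun x hx => propext hx
  rw [IsUnitNormal, IsUnitNormal, tangentConeAt_congr (nhdsWithin_eq_iff_eventuallyEq.2 h1)]

/-- A set contained in a graph has a unit normal. -/
theorem IsHyperplaneFrame.exists_isUnitNormal (H : IsHyperplaneFrame ι ν) {x₀ : Space n}
    {w : Space (n - 1) → ℝ} {M : Set (Space n)} {y : Space (n - 1)} (hw : DifferentiableAt ℝ w y)
    (hM : ∀ᶠ x in 𝓝 (graphMap ι ν x₀ w y), x ∈ M → x ∈ range (graphMap ι ν x₀ w)) :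
    ∃ μ, IsUnitNormal M (graphMap ι ν x₀ w y) μ := by
  set p := graphMap ι ν x₀ w y
  let g : Space n → ℝ := fun x => ⟪ν, x - x₀⟫ - w (frameProj ι (x - x₀))
  have hpy : frameProj ι (p - x₀) = y := by
    have : p - x₀ = ι y + w y • ν := by simp [p, graphMap]
    rw [this, H.frameProj_add]
  have hg : HasGradientAt g (ν - ι (∇ w y)) p := by
    rw [hasGradientAt_iff_hasFDerivAt]
    have h1 : HasFDerivAt (fun x : Space n => x - x₀) (ContinuousLinearMap.id ℝ (Space n)) p :=
      (hasFDerivAt_id p).sub_const x₀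
    have h2 : HasFDerivAt w (innerSL ℝ (∇ w y)) (frameProj ι (p - x₀)) := by
      rw [hpy]; exact hw.hasGradientAt.hasFDerivAt
    have h3 := ((innerSL ℝ ν).hasFDerivAt.comp p h1).sub
      (h2.comp p ((frameProj ι).hasFDerivAt.comp p h1))
    refine h3.congr_fderiv ?_
    ext a
    have h5 : ⟪∇ w y, frameProj ι a⟫ = ⟪ι (∇ w y), a⟫ :=
      ContinuousLinearMap.adjoint_inner_right _ _ _
    simp [h5]
  have hN : ν - ι (∇ w y) ≠ 0 := by
    intro h0
    have := H.norm_sub_sq (∇ w y)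
    rw [h0, norm_zero] at this
    nlinarith [sq_nonneg ‖∇ w y‖]
  refine ⟨‖ν - ι (∇ w y)‖⁻¹ • (ν - ι (∇ w y)), isUnitNormal_of_subset_zeroSet (g := g)
    hg.differentiableAt ?_ ?_ (norm_smul_inv_norm hN) (norm_ne_zero_iff.2 hN) ?_⟩
  · exact sub_eq_zero.2 (H.mem_range_graphMap.1 (mem_range_self y)).symm
  · filter_upwards [hM] with x hx hxM
    exact sub_eq_zero.2 (H.mem_range_graphMap.1 (hx hxM)).symm
  · rw [hg.gradient, smul_inv_smul₀ (norm_ne_zero_iff.2 hN)]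

/-- A surface whose transport density is `c` off a set `K`, and less than `c` on average over `K`,
has transport functional less than `c`. -/
theorem transportFunctional_lt {T : Space n → Space n →L[ℝ] Space n} {M K : Set (Space n)} {c : ℝ}
    (hM : MeasurableSet M) (hK : MeasurableSet K) (hfin : μHE[n - 1] M ≠ ⊤)
    (hpos : μHE[n - 1] M ≠ 0)
    (hoff : ∀ p ∈ M \ K, ⟪unitNormal M p, T p (unitNormal M p)⟫ = c)
    (hint : IntegrableOn (fun p => ⟪unitNormal M p, T p (unitNormal M p)⟫) (M ∩ K) μHE[n - 1])
    (hneg : ∫ p in M ∩ K, (⟪unitNormal M p, T p (unitNormal M p)⟫ - c) ∂μHE[n - 1] < 0) :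
    transportFunctional T M < c := by
  have hfin' : ∀ s, s ⊆ M → μHE[n - 1] s ≠ ⊤ := fun s hs =>
    ((measure_mono hs).trans_lt hfin.lt_top).ne
  have hoffi : IntegrableOn (fun p => ⟪unitNormal M p, T p (unitNormal M p)⟫) (M \ K)
      μHE[n - 1] :=
    (integrableOn_const (hfin' _ sdiff_subset)).congr_fun (fun p hp => (hoff p hp).symm)
      (hM.diff hK)
  have hall : IntegrableOn (fun p => ⟪unitNormal M p, T p (unitNormal M p)⟫) M μHE[n - 1] := by
    have := hint.union hoffi
    rwa [inter_union_sdiff] at this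
  have hr : 0 < (μHE[n - 1]).real M := ENNReal.toReal_pos hpos hfin
  rw [transportFunctional, div_lt_iff₀ hr, ← integral_inter_add_sdiff hK hall,
    setIntegral_congr_fun (hM.diff hK) hoff, setIntegral_const, smul_eq_mul,
    ← measureReal_inter_add_sdiff (s := M) hK hfin]
  rw [integral_sub hint (integrableOn_const (hfin' _ inter_subset_left)), setIntegral_const,
    smul_eq_mul] at hneg
  linarith

end GraphDensity

section Displacement

variable {E : Type*} [NormedAddCommGroup E] {h : E → E} {K M : Set E}

theorem injective_add_of_lipschitzWith {k : ℝ≥0} (hk : k < 1) (hh : LipschitzWith k h) :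
    Function.Injective fun x => x + h x := by
  intro x y hxy
  have h1 := hh.dist_le_mul x y
  have h2 : dist (h x) (h y) = dist x y := by
    rw [dist_comm x, dist_eq_norm, dist_eq_norm]
    congr 1
    have hxy' : x + h x = y + h y := hxy
    rw [sub_eq_sub_iff_add_eq_add, add_comm, hxy', add_comm]
  rw [h2] at h1
  by_contra hne
  have h3 : 0 < dist x y := dist_pos.2 hne
  have h4 : (k : ℝ) < 1 := hk
  nlinarith

/-- The map `x ↦ x + h x` fixes every point off `K`, so by injectivity it sends `K` into `K`; the
surface changes only inside `K`. -/
theorem image_add_sdiff_of_eq_zero (hinj : Function.Injective fun x => x + h x)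
    (hK : ∀ x, x ∉ K → h x = 0) : (fun x => x + h x) '' M \ K = M \ K := by
  ext x
  constructor
  · rintro ⟨⟨q, hq, rfl⟩, hx⟩
    have h1 : q + h q = q := hinj (by simp [hK _ hx])
    simp only [h1] at hx ⊢
    exact ⟨hq, hx⟩
  · rintro ⟨hx, hxK⟩
    exact ⟨⟨x, hx, by simp [hK x hxK]⟩, hxK⟩

theorem image_add_inter_of_eq_zero (hinj : Function.Injective fun x => x + h x)
    (hK : ∀ x, x ∉ K → h x = 0) :
    (fun x => x + h x) '' M ∩ K = (fun x => x + h x) '' (M ∩ K) := by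
  ext x
  constructor
  · rintro ⟨⟨q, hq, rfl⟩, hx⟩
    refine ⟨q, ⟨hq, by_contra fun hqK => hqK ?_⟩, rfl⟩
    simpa [hK q hqK] using hx
  · rintro ⟨q, ⟨hq, hqK⟩, rfl⟩
    refine ⟨⟨q, hq, rfl⟩, by_contra fun hx => hx ?_⟩
    have h1 : q + h q = q := hinj (by simp [hK _ hx])
    simpa only [h1] using hqK

end Displacement

section Bump

variable {V E : Type*} [NormedAddCommGroup V] [InnerProductSpace ℝ V]
  [NormedAddCommGroup E] [InnerProductSpace ℝ E]

/-- The displacement in the direction `ν` by the rescaled test function `s r u((x - x₀) / r)`. -/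
noncomputable def bumpField (ν x₀ : E) (u : E → ℝ) (s r : ℝ) (x : E) : E :=
  (s * r * u (r⁻¹ • (x - x₀))) • ν

variable {ν x₀ : E} {u : E → ℝ} {s r : ℝ}

theorem contDiff_bumpField (hu : ContDiff ℝ ∞ u) : ContDiff ℝ ∞ (bumpField ν x₀ u s r) :=
  (contDiff_const.mul (hu.comp (contDiff_const.smul (contDiff_id.sub contDiff_const)))).smul
    contDiff_const

theorem bumpField_eq_zero (hu0 : ∀ x, 1 / 2 < ‖x‖ → u x = 0) (hr : 0 < r) {x : E}
    (hx : x ∉ Metric.closedBall x₀ (r / 2)) : bumpField ν x₀ u s r x = 0 := by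
  rw [bumpField, hu0, mul_zero, zero_smul]
  rw [mem_closedBall_iff_norm, not_le] at hx
  rw [norm_smul, norm_inv, Real.norm_eq_abs, abs_of_pos hr, inv_mul_eq_div, lt_div_iff₀ hr]
  linarith

theorem norm_bumpField_le (hν : ‖ν‖ = 1) (hs : 0 ≤ s) (hr : 0 ≤ r) {C : ℝ} (hC : ∀ x, ‖u x‖ ≤ C)
    (x : E) : ‖bumpField ν x₀ u s r x‖ ≤ s * r * C := by
  rw [bumpField, norm_smul, hν, mul_one, norm_mul, Real.norm_of_nonneg (by positivity)]
  gcongr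
  exact hC _

theorem norm_fderiv_bumpField_le (hu : Differentiable ℝ u) (hν : ‖ν‖ = 1) (hs : 0 ≤ s) (hr : 0 < r)
    {C : ℝ} (hC : ∀ x, ‖fderiv ℝ u x‖ ≤ C) (x : E) :
    ‖fderiv ℝ (bumpField ν x₀ u s r) x‖ ≤ s * C := by
  have h1 : HasFDerivAt (fun x : E => r⁻¹ • (x - x₀)) (r⁻¹ • ContinuousLinearMap.id ℝ E) x :=
    ((hasFDerivAt_id x).sub_const x₀).const_smul r⁻¹
  have h2 := (((hu _).hasFDerivAt.comp x h1).const_mul (s * r)).smul_const ν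
  have h3 : fderiv ℝ (bumpField ν x₀ u s r) x = s • (fderiv ℝ u (r⁻¹ • (x - x₀))).smulRight ν := by
    refine (h2.congr_fderiv ?_).fderiv
    ext a
    simp [smul_smul]
    field_simp
  rw [h3, norm_smul, ContinuousLinearMap.norm_smulRight_apply, hν, mul_one,
    Real.norm_of_nonneg hs]
  gcongr
  exact hC _

theorem gradient_comp_linearIsometry [FiniteDimensional ℝ V] [FiniteDimensional ℝ E]
    (ι : V →ₗᵢ[ℝ] E) (hu : Differentiable ℝ u) (z : V) :
    ∇ (u ∘ ι) z = frameProj ι (∇ u (ι z)) := by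
  refine HasGradientAt.gradient (hasGradientAt_iff_hasFDerivAt.2 ?_)
  have h1 : HasFDerivAt u (innerSL ℝ (∇ u (ι z))) (ι z) := (hu _).hasGradientAt.hasFDerivAt
  refine (h1.comp z ι.toContinuousLinearMap.hasFDerivAt).congr_fderiv ?_
  ext a
  exact (ContinuousLinearMap.adjoint_inner_left ι.toContinuousLinearMap a (∇ u (ι z))).symm

end Bump

end DiffusiveTransport

/-! ### Lowering the functional where the trace is negative. -/

namespace DiffusiveTransport

open Module Filter
open scoped Gradient

variable {n : ℕ} {ι : Space (n - 1) →ₗᵢ[ℝ] Space n} {ν x₀ : Space n}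

/-- If part of a surface is a graph, then the excess of the transport density over `c` is
integrated by `graphIntegrand`. -/
theorem IsHyperplaneFrame.setIntegral_density (H : IsHyperplaneFrame ι ν)
    {w : Space (n - 1) → ℝ} (hw : ContDiff ℝ 1 w) (hc : HasCompactSupport w)
    {M : Set (Space n)} {S : Set (Space (n - 1))} (hS : IsCompact S)
    (hSM : ∀ y ∈ S, ∀ᶠ z in 𝓝 y, graphMap ι ν x₀ w z ∈ M)
    (hMS : ∀ y ∈ S, ∀ᶠ x in 𝓝 (graphMap ι ν x₀ w y), x ∈ M → x ∈ range (graphMap ι ν x₀ w))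
    {T : Space n → Space n →L[ℝ] Space n} (hT : ContinuousOn T (graphMap ι ν x₀ w '' S)) (c : ℝ) :
    IntegrableOn (fun p => ⟪unitNormal M p, T p (unitNormal M p)⟫) (graphMap ι ν x₀ w '' S)
      μHE[n - 1] ∧
    ∫ p in graphMap ι ν x₀ w '' S, (⟪unitNormal M p, T p (unitNormal M p)⟫ - c) ∂μHE[n - 1] =
      ∫ y in S, graphIntegrand ι ν (shiftedTensor T c (graphMap ι ν x₀ w y)) (∇ w y) := by
  set φ := graphMap ι ν x₀ w
  have hwd : Differentiable ℝ w := hw.differentiable one_ne_zero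
  have hφS : IsCompact (φ '' S) := hS.image (continuous_graphMap hw.continuous)
  have hden : ∀ y ∈ S, ⟪unitNormal M (φ y), T (φ y) (unitNormal M (φ y))⟫ =
      ⟪ν - ι (∇ w y), T (φ y) (ν - ι (∇ w y))⟫ / (1 + ‖∇ w y‖ ^ 2) := fun y hy =>
    H.inner_of_isUnitNormal (hwd y) (hSM y hy)
      (isUnitNormal_unitNormal_of_exists (H.exists_isUnitNormal (hwd y) (hMS y hy))) _
  constructor
  · let q : Space n → Space (n - 1) := fun x => ∇ w (frameProj ι (x - x₀))
    have hqc : Continuous q := (continuous_gradient hw).comp (by fun_prop)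
    have hq : ∀ y, q (φ y) = ∇ w y := fun y => by
      have : φ y - x₀ = ι y + w y • ν := by simp [φ, graphMap]
      simp only [q]
      rw [this, H.frameProj_add]
    have hcont : ContinuousOn (fun x => ⟪ν - ι (q x), T x (ν - ι (q x))⟫ / (1 + ‖q x‖ ^ 2))
        (φ '' S) := by
      have hN : Continuous fun x => ν - ι (q x) := continuous_const.sub (ι.continuous.comp hqc)
      exact ContinuousOn.div (hN.continuousOn.inner (hT.clm_apply hN.continuousOn))
        (by fun_prop) fun x _ => by positivity
    obtain ⟨C, hC⟩ := hφS.exists_bound_of_continuousOn hcont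
    refine IntegrableOn.congr_fun (f := fun x => ⟪ν - ι (q x), T x (ν - ι (q x))⟫ /
      (1 + ‖q x‖ ^ 2)) ?_ ?_ hφS.measurableSet
    · refine ⟨hcont.aestronglyMeasurable_of_isCompact hφS hφS.measurableSet, ?_⟩
      exact .restrict_of_bounded (C := C)
        (euclideanHausdorffMeasure_graphMap_image_lt_top H x₀ hw hc hS.isBounded)
        ((ae_restrict_iff' hφS.measurableSet).2 (.of_forall hC))
    · rintro _ ⟨y, hy, rfl⟩
      simp only [hq]
      exact (hden y hy).symm
  · rw [H.setIntegral_graphMap_image x₀ hw hc hS.measurableSet]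
    refine setIntegral_congr_fun hS.measurableSet fun y hy => ?_
    have h1 := hden y hy
    change √(1 + ‖∇ w y‖ ^ 2) * (⟪unitNormal M (φ y), T (φ y) (unitNormal M (φ y))⟫ - c) = _
    have hpos : 0 < 1 + ‖∇ w y‖ ^ 2 := by positivity
    have hsq : √(1 + ‖∇ w y‖ ^ 2) ^ 2 = 1 + ‖∇ w y‖ ^ 2 := Real.sq_sqrt hpos.le
    have hs0 : √(1 + ‖∇ w y‖ ^ 2) ≠ 0 := (Real.sqrt_pos.2 hpos).ne'
    have h2 : ⟪ν - ι (∇ w y), ν - ι (∇ w y)⟫ = 1 + ‖∇ w y‖ ^ 2 := by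
      rw [real_inner_self_eq_norm_sq, H.norm_sub_sq]
    rw [h1, graphIntegrand, shiftedTensor, eq_div_iff hs0]
    have h3 : ⟪ν - ι (∇ w y), T (φ y) (ν - ι (∇ w y)) - c • (ν - ι (∇ w y))⟫ =
        ⟪ν - ι (∇ w y), T (φ y) (ν - ι (∇ w y))⟫ - c * (1 + ‖∇ w y‖ ^ 2) := by
      rw [inner_sub_right, inner_smul_right, h2]
    rw [mul_right_comm, ← sq, hsq]
    refine Eq.trans ?_ h3.symm
    field_simp

/-- Where the trace of `T - c I` is negative, a surface of constant transport density `c` can be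
wrinkled so as to decrease the transport functional. -/
theorem IsHypersurface.exists_perturb_lt (hn : 1 ≤ n) {M : Set (Space n)} (hM : IsHypersurface M)
    {W : Set (Space n)} (hW : IsOpen W) (hMW : M ⊆ W) {T : Space n → Space n →L[ℝ] Space n}
    (hT : ContinuousOn T W) {c : ℝ} (hc : ∀ p ∈ M, ∀ μ, IsUnitNormal M p μ → ⟪μ, T p μ⟫ = c)
    (hx₀ : IsInteriorPoint M x₀) (htr : tensorTrace (shiftedTensor T c x₀) < 0) {δ : ℝ}
    (hδ : 0 < δ) :
    ∃ h, IsAdmissible M δ h ∧ perturb h M ⊆ W ∧ transportFunctional T (perturb h M) < c := by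
  obtain ⟨ν, ι, w, H, hw, hwc, hw0, hw1, hgr⟩ := hx₀.exists_graph hn
  have hx₀W : x₀ ∈ W := hMW hx₀.1
  have hA : ContinuousOn (shiftedTensor T c) W := hT.sub continuousOn_const
  have hφ0 : graphMap ι ν x₀ w 0 = x₀ := graphMap_zero hw0
  have hφc : Continuous (graphMap ι ν x₀ w) := continuous_graphMap hw.continuous
  have hν : ⟪ν, shiftedTensor T c x₀ ν⟫ = 0 := by
    have h1 : ∀ᶠ z in 𝓝 0, graphMap ι ν x₀ w z ∈ M := by
      have := hφc.tendsto 0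
      rw [hφ0] at this
      exact (this.eventually hgr).mono fun z hz => hz.2 (mem_range_self _)
    have h2 := hM.isUnitNormal_unitNormal hx₀.1
    have h3 := H.inner_of_isUnitNormal (hw.differentiable one_ne_zero 0) h1
      (by rw [hφ0]; exact h2) (T x₀)
    rw [hc x₀ hx₀.1 _ h2, hw1, map_zero, sub_zero, norm_zero] at h3
    have h4 : ⟪ν, T x₀ ν - c • ν⟫ = ⟪ν, T x₀ ν⟫ - c := by
      rw [inner_sub_right, inner_smul_right, H.inner_self, mul_one]
    refine h4.trans ?_
    rw [h3]; simp
  obtain ⟨e, he⟩ := H.exists_inner_neg_of_trace_neg hν htr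
  obtain ⟨u, hu, hu0, hQ⟩ := H.exists_testFunction _ he
  have hu1 : ContDiff ℝ 1 u := hu.of_le (by simp)
  have hud : Differentiable ℝ u := hu1.differentiable one_ne_zero
  have huc : HasCompactSupport u := HasCompactSupport.intro (isCompact_closedBall 0 (1 / 2))
    fun x hx => hu0 x (by simpa using hx)
  obtain ⟨C, hC⟩ := huc.exists_bound_of_continuous hu.continuous
  obtain ⟨G, hG⟩ := (huc.fderiv ℝ).exists_bound_of_continuous (hu1.continuous_fderiv one_ne_zero)
  have hG0 : 0 ≤ G := (norm_nonneg _).trans (hG 0)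
  -- The slope parameter is fixed before the scale. Its bound keeps the derivative of the
  -- displacement below `δ`, and below `1 / 2` so that `x ↦ x + h x` is injective. The scale `r`
  -- then controls the size and the support.
  obtain ⟨s, hs, hsle, hsneg⟩ := exists_integral_graphIntegrand_neg (f := u ∘ ι) (R := 1 / 2)
    (s₀ := min δ (1 / 2) / (G + 1)) hν (hu1.comp ι.toContinuousLinearMap.contDiff)
    (fun z hz => hu0 _ (by rwa [ι.norm_map]))
    (by simpa only [gradient_comp_linearIsometry ι hud] using hQ) (by positivity)
  simp only [gradient_comp_linearIsometry ι hud] at hsneg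
  have hsG : s * G ≤ min δ (1 / 2) := by
    rw [le_div_iff₀ (by positivity)] at hsle
    nlinarith
  have hlim := H.eventually_integral_wrinkle_neg hW hx₀W hA hν hw hwc hw0 hw1 hu1 hu0 hsneg
  -- In this ball the surface is the graph, has no boundary points and stays inside `W`.
  obtain ⟨ρ, hρ, hball⟩ := Metric.mem_nhds_iff.1
    ((hgr.and hx₀.eventually).and (hW.mem_nhds hx₀W))
  have hr : ∀ᶠ r in 𝓝[>] (0 : ℝ), 0 < r ∧ r < ρ ∧ s * r * C < δ :=
    (eventually_mem_nhdsWithin).and (Eventually.filter_mono nhdsWithin_le_nhds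
      ((gt_mem_nhds hρ).and ((by fun_prop : Continuous fun r : ℝ => s * r * C).continuousAt.eventually
        (gt_mem_nhds (by simpa using hδ)))))
  obtain ⟨r, hrneg, hr0, hrρ, hrC⟩ := (hlim.and hr).exists
  set w₁ := wrinkle ι ν w u s r with hw₁
  set h := bumpField ν x₀ u s r with hh
  set K := Metric.closedBall x₀ r
  set S : Set (Space (n - 1)) := {y | ‖ι y + w y • ν‖ ≤ r}
  have hSK : ∀ y, y ∈ S ↔ graphMap ι ν x₀ w y ∈ K := fun y => by
    simp [S, K, graphMap]
  have hKρ : K ⊆ Metric.ball x₀ ρ := Metric.closedBall_subset_ball hrρ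
  have hMgr : ∀ x ∈ Metric.ball x₀ ρ, x ∈ M ↔ x ∈ range (graphMap ι ν x₀ w) := fun x hx =>
    (hball hx).1.1
  have hhd : ∀ x, ‖fderiv ℝ h x‖ ≤ min δ (1 / 2) := fun x =>
    (norm_fderiv_bumpField_le hud H.norm_eq_one hs.le hr0 hG x).trans hsG
  have hhlip : LipschitzWith (1 / 2) h := by
    refine lipschitzWith_of_nnnorm_fderiv_le ((contDiff_bumpField hu).differentiable (by simp))
      fun x => ?_
    rw [← NNReal.coe_le_coe, coe_nnnorm]
    simpa using (hhd x).trans (min_le_right _ _)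
  have hinj : Function.Injective fun x => x + h x :=
    injective_add_of_lipschitzWith (by rw [← NNReal.coe_lt_coe]; norm_num) hhlip
  have hh0 : ∀ x, x ∉ Metric.closedBall x₀ (r / 2) → h x = 0 := fun x hx =>
    bumpField_eq_zero hu0 hr0 hx
  have hhK : ∀ x, x ∉ K → h x = 0 := fun x hx =>
    hh0 x fun hx' => hx (Metric.closedBall_subset_closedBall (by linarith) hx')
  have hΦφ : ∀ y, graphMap ι ν x₀ w₁ y = graphMap ι ν x₀ w y + h (graphMap ι ν x₀ w y) :=
    graphMap_wrinkle x₀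
  have hw₁d : ContDiff ℝ 1 w₁ := contDiff_wrinkle hw hu1
  have hw₁c : HasCompactSupport w₁ := H.hasCompactSupport_wrinkle hwc hu0 hr0
  have hsd : perturb h M \ K = M \ K := image_add_sdiff_of_eq_zero hinj hhK
  have hin : perturb h M ∩ K = graphMap ι ν x₀ w₁ '' S := by
    rw [perturb, image_add_inter_of_eq_zero hinj hhK]
    have : M ∩ K = graphMap ι ν x₀ w '' S := by
      ext x
      constructor
      · rintro ⟨hxM, hxK⟩
        obtain ⟨y, rfl⟩ := (hMgr x (hKρ hxK)).1 hxM
        exact ⟨y, (hSK y).2 hxK, rfl⟩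
      · rintro ⟨y, hy, rfl⟩
        have hyK := (hSK y).1 hy
        exact ⟨(hMgr _ (hKρ hyK)).2 (mem_range_self y), hyK⟩
    rw [this, image_image]
    exact image_congr fun y _ => (hΦφ y).symm
  have hK : IsClosed K := Metric.isClosed_closedBall
  have hS : IsCompact S := by
    refine Metric.isCompact_of_isClosed_isBounded (isClosed_le ((ι.continuous.add
      (hw.continuous.smul continuous_const)).norm) continuous_const)
      ((Metric.isBounded_closedBall (x := 0) (r := r)).subset fun y hy => ?_)
    rw [mem_closedBall_zero_iff]
    exact (H.norm_le_norm_add _ _).trans hy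
  have hM'c : IsCompact (perturb h M) :=
    hM.isCompact.image (continuous_id.add hhlip.continuous)
  have hM'W : perturb h M ⊆ W := by
    rw [← sdiff_union_inter (perturb h M) K, hsd]
    exact union_subset (sdiff_subset.trans hMW)
      (inter_subset_right.trans (hKρ.trans fun x hx => (hball hx).2))
  have hM'range : ∀ x ∈ Metric.ball x₀ ρ, x ∈ perturb h M → x ∈ range (graphMap ι ν x₀ w₁) := by
    intro x hx hxM
    by_cases hxK : x ∈ K
    · obtain ⟨y, -, hy⟩ := hin.subset ⟨hxM, hxK⟩
      exact ⟨y, hy⟩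
    · obtain ⟨y, hy⟩ := (hMgr x hx).1 (hsd.subset ⟨hxM, hxK⟩).1
      exact ⟨y, by rw [hΦφ, hy, hhK x hxK, add_zero]⟩
  have hSM : ∀ y ∈ S, ∀ᶠ z in 𝓝 y, graphMap ι ν x₀ w₁ z ∈ perturb h M := by
    intro y hy
    filter_upwards [hφc.continuousAt.eventually
      (Metric.isOpen_ball.mem_nhds (hKρ ((hSK y).1 hy)))] with z hz
    exact ⟨_, (hMgr _ hz).2 (mem_range_self z), (hΦφ z).symm⟩
  have hφ₁K : ∀ y ∈ S, graphMap ι ν x₀ w₁ y ∈ K := fun y hy =>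
    (hin.superset (mem_image_of_mem _ hy)).2
  have hden := H.setIntegral_density hw₁d hw₁c hS hSM (fun y hy => by
    filter_upwards [Metric.isOpen_ball.mem_nhds (hKρ (hφ₁K y hy))] with x hx
    exact hM'range x hx) (T := T) (hT.mono (by
      rw [← hin]; exact inter_subset_left.trans hM'W)) c
  rw [← hin] at hden
  refine ⟨h, ⟨contDiff_bumpField hu, HasCompactSupport.intro (isCompact_closedBall x₀ (r / 2)) hh0,
    ?_, fun x => ⟨(norm_bumpField_le H.norm_eq_one hs.le hr0.le hC x).trans hrC.le,
      (hhd x).trans (min_le_left _ _)⟩⟩, hM'W, ?_⟩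
  · have hts : tsupport h ⊆ Metric.ball x₀ ρ := by
      refine (closure_minimal (fun x hx => ?_) hK).trans hKρ
      by_contra hx'
      exact hx (hhK x hx')
    rw [Set.disjoint_left]
    exact fun x hx hxb => hxb.2 ((hball (hts hx)).1.2 hxb.1)
  -- Only compactness, finite positive area and the unit normals of the perturbed surface enter. Off
  -- `K` it coincides locally with `M`, so the normals and the density `c` are unchanged there.
  · refine transportFunctional_lt hM'c.measurableSet hK.measurableSet ?_ ?_ ?_ hden.1
      (hden.2.trans_lt hrneg)
    · refine ((LipschitzWith.id.add hhlip).lipschitzOnWith.euclideanHausdorffMeasure_image_le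
        (s := M) (n - 1)).trans_lt ?_ |>.ne
      exact ENNReal.mul_lt_top (ENNReal.pow_lt_top ENNReal.coe_lt_top) (hM.measure_lt_top hn)
    · have hS0 : S ∈ 𝓝 0 := by
        have : ContinuousAt (fun y : Space (n - 1) => ‖ι y + w y • ν‖) 0 :=
          ((ι.continuous.add (hw.continuous.smul continuous_const)).norm).continuousAt
        filter_upwards [this.eventually (gt_mem_nhds (by simpa [hw0] using hr0))] with y hy
        exact hy.le
      refine ((Measure.measure_pos_of_mem_nhds volume hS0).trans_le
        ((volume_le_euclideanHausdorffMeasure_graphMap_image H x₀ w₁ _).trans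
          (measure_mono ?_))).ne'
      rw [← hin]
      exact inter_subset_left
    · intro p hp
      have hpM := hsd.subset hp
      have hloc : ∀ᶠ x in 𝓝 p, x ∈ perturb h M ↔ x ∈ M := by
        filter_upwards [hK.isOpen_compl.mem_nhds hp.2] with x hx
        have h1 := Set.ext_iff.1 hsd x
        simpa [show x ∉ K from hx] using h1
      refine hc p hpM.1 _ ((isUnitNormal_congr hloc).1 (isUnitNormal_unitNormal_of_exists ?_))
      exact ⟨_, (isUnitNormal_congr hloc).2 (hM.isUnitNormal_unitNormal hpM.1)⟩

end DiffusiveTransport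

/-! ### The null-surface identity and the trace inequalities. -/

namespace DiffusiveTransport

open Filter

variable {n : ℕ} {M W : Set (Space n)} {T : Space n → Space n →L[ℝ] Space n}

theorem continuous_tensorTrace : Continuous (tensorTrace : (Space n →L[ℝ] Space n) → ℝ) :=
  ((LinearMap.trace ℝ (Space n)).comp
    (ContinuousLinearMap.coeLM ℝ (M := Space n) (N₃ := Space n))).continuous_of_finiteDimensional

theorem IsHypersurface.isNullSurface (hn : 1 ≤ n) (hM : IsHypersurface M) (h : IsUniform T M) :
    IsNullSurface (shiftedTensor T (transportFunctional T M)) M := by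
  obtain ⟨c, hc⟩ := h
  intro p hp ν hν
  have h1 : ⟪ν, T p ν - transportFunctional T M • ν⟫ = 0 := by
    rw [hM.transportFunctional_eq hn ⟨p, hp⟩ hc, inner_sub_right, inner_smul_right, hc p hp ν hν,
      real_inner_self_eq_norm_sq, hν.1]
    ring
  exact h1

theorem IsHypersurface.tensorTrace_nonneg (hn : 1 ≤ n) (hM : IsHypersurface M) (hW : IsOpen W)
    (hMW : M ⊆ W) (hT : ContinuousOn T W) (h : IsUniformMinimizer W T M) {x₀ : Space n}
    (hx₀ : x₀ ∈ M) : 0 ≤ tensorTrace (shiftedTensor T (transportFunctional T M) x₀) := by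
  obtain ⟨⟨c, hc⟩, δ, hδ, hmin⟩ := h
  have hTc := hM.transportFunctional_eq hn ⟨x₀, hx₀⟩ hc
  rw [hTc] at hmin ⊢
  by_contra! hneg
  have hcont : ContinuousAt (fun x => tensorTrace (shiftedTensor T c x)) x₀ :=
    continuous_tensorTrace.continuousAt.comp
      ((hT.sub continuousOn_const).continuousAt (hW.mem_nhds (hMW hx₀)))
  -- The point `x₀` may lie on the boundary, where no displacement is allowed; a negative trace
  -- persists at some nearby interior point.
  obtain ⟨x, hxi, hx⟩ := ((hM.frequently_isInteriorPoint hn hx₀).and_eventually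
    (hcont.eventually (gt_mem_nhds hneg))).exists
  obtain ⟨h, hadm, hW', hlt⟩ := hM.exists_perturb_lt hn hW hMW hT hc hxi hx hδ
  exact (hmin h hadm hW').not_gt hlt

theorem transportFunctional_neg :
    transportFunctional (-T) M = -transportFunctional T M := by
  simp only [transportFunctional, Pi.neg_apply, neg_apply, inner_neg_right,
    integral_neg, neg_div]

theorem IsUniform.neg (h : IsUniform T M) : IsUniform (-T) M := by
  obtain ⟨c, hc⟩ := h
  refine ⟨-c, fun p hp ν hν => ?_⟩
  rw [← hc p hp ν hν]
  exact inner_neg_right _ _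

theorem IsUniformMaximizer.neg (h : IsUniformMaximizer W T M) : IsUniformMinimizer W (-T) M := by
  obtain ⟨hu, δ, hδ, hmax⟩ := h
  refine ⟨hu.neg, δ, hδ, fun h hadm hW => ?_⟩
  rw [transportFunctional_neg, transportFunctional_neg]
  exact neg_le_neg (hmax h hadm hW)

theorem tensorTrace_shiftedTensor_neg (c : ℝ) (x : Space n) :
    tensorTrace (shiftedTensor (-T) (-c) x) = -tensorTrace (shiftedTensor T c x) := by
  have : shiftedTensor (-T) (-c) x = -shiftedTensor T c x := by
    change -T x - -c • ContinuousLinearMap.id ℝ (Space n) =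
      -(T x - c • ContinuousLinearMap.id ℝ (Space n))
    module
  rw [this, tensorTrace, tensorTrace, ContinuousLinearMap.toLinearMap_neg, map_neg]

theorem IsHypersurface.tensorTrace_nonpos (hn : 1 ≤ n) (hM : IsHypersurface M) (hW : IsOpen W)
    (hMW : M ⊆ W) (hT : ContinuousOn T W) (h : IsUniformMaximizer W T M) {x₀ : Space n}
    (hx₀ : x₀ ∈ M) : tensorTrace (shiftedTensor T (transportFunctional T M) x₀) ≤ 0 := by
  have := hM.tensorTrace_nonneg hn hW hMW hT.neg h.neg hx₀
  rwa [transportFunctional_neg, tensorTrace_shiftedTensor_neg, neg_nonneg] at this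

end DiffusiveTransport

theorem theorem1 (n : ℕ) (hn : 1 ≤ n) (U : Set (Space n)) (hU : IsCompact U)
    (t₀ t₁ : ℝ) (ht : t₀ < t₁)
    (v : ℝ → Space n → Space n) (hv : IsIncompressibleSmoothField U t₀ t₁ v)
    (D : ℝ → Space n → Space n →L[ℝ] Space n) (hD : IsDiffusionTensor U t₀ t₁ D)
    (F : ℝ → Space n → Space n) (hF : IsFlowMap U t₀ t₁ v F)
    (M₀ : Set (Space n)) (hM : IsHypersurface M₀) (hMU : M₀ ⊆ interior U)
    (Tbar : Space n → Space n →L[ℝ] Space n) (hTbar : Tbar = transportTensor D F t₀ t₁)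
    (T₀ : ℝ) (hT₀ : T₀ = transportFunctional Tbar M₀) :
    (IsUniformMinimizer (interior U) Tbar M₀ →
      IsNullSurface (shiftedTensor Tbar T₀) M₀ ∧
        ∀ x₀ ∈ M₀, 0 ≤ tensorTrace (shiftedTensor Tbar T₀ x₀)) ∧
    (IsUniformMaximizer (interior U) Tbar M₀ →
      IsNullSurface (shiftedTensor Tbar T₀) M₀ ∧
        ∀ x₀ ∈ M₀, tensorTrace (shiftedTensor Tbar T₀ x₀) ≤ 0) := by
  subst hTbar hT₀
  have hT := continuousOn_transportTensor hU ht hv hD hF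
  exact ⟨fun h => ⟨hM.isNullSurface hn h.1, fun x₀ hx₀ =>
      hM.tensorTrace_nonneg hn isOpen_interior hMU hT h hx₀⟩,
    fun h => ⟨hM.isNullSurface hn h.1, fun x₀ hx₀ =>
      hM.tensorTrace_nonpos hn isOpen_interior hMU hT h hx₀⟩⟩
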